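/- Let $d\ge 1$, let $\hat A,\hat B$ be finite-dimensional quantum systems, let $A\cong B$ be $d$-dimensional systems, and let $\mathcal N_{\hat A\to\hat B}$ be a quantum channel (a completely positive trace-preserving map). An LOCR protocol is a (finite) collection $\mathcal P=\{(p(y),\mathcal E^y_{A\to\hat A},\mathcal D^y_{\hat B\to B})\}_y$, where $p$ is a probability distribution and all $\mathcal E^y,\mathcal D^y$ are quantum channels; it induces the LOCR superchannel $\Upsilon(\mathcal M)=\sum_y p(y)\,\mathcal D^y\circ\mathcal M\circ\mathcal E^y$. Denote by $\mathrm{LOCR}$ the set of all such superchannels and put $$e_{\mathrm{LOCR}}(\mathcal N,\Upsilon)=\tfrac12\big\|\mathrm{id}^d-\Upsilon(\mathcal N)\big\|_\diamond,\qquad e^F_{\mathrm{LOCR}}(\mathcal N,\Upsilon)=1-F\big(\mathrm{id}^d,\Upsilon(\mathcal N)\big),$$ $$e_{\mathrm{LOCR}}(\mathcal N)=\inf_{\Upsilon\in\mathrm{LOCR}}e_{\mathrm{LOCR}}(\mathcal N,\Upsilon),\qquad e^F_{\mathrm{LOCR}}(\mathcal N)=\inf_{\Upsilon\in\mathrm{LOCR}}e^F_{\mathrm{LOCR}}(\mathcal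 N,\Upsilon).$$ Here $\|\mathcal M-\mathcal M'\|_\diamond=\sup_{\rho_{RA}}\|\mathcal M(\rho_{RA})-\mathcal M'(\rho_{RA})\|_1$ and $F(\mathcal M,\mathcal M')=\inf_{\rho_{RA}}F(\mathcal M(\rho_{RA}),\mathcal M'(\rho_{RA}))$, over all states $\rho_{RA}$ with an arbitrarily large finite-dimensional reference system $R$, with $F(\omega,\tau)=\|\sqrt\omega\sqrt\tau\|_1^2$. The entanglement fidelity of $\mathcal P$ is $$E_F(\mathcal N;\mathcal P)=\sum_y p(y)\operatorname{Tr}\big[\Phi^d\,(\mathrm{id}\otimes\mathcal D^y\circ\mathcal N\circ\mathcal E^y)(\Phi^d)\big],\qquad \Phi^d=\frac1d\sum_{i,j=0}^{d-1}|i\rangle\langle j|\otimes|i\rangle\langle j|.$$ Then $E_F(\mathcal N;\mathcal P)\in[0,1]$ for every LOCR protocol $\mathcal P$, and $$e_{\mathrm{LOCR}}(\mathcal N)=e^F_{\mathrm{LOCR}}(\mathcal N)=1-\sup_{\mathcal P}E_F(\mathcal N;\mathcal P),$$ where the supremum is over all LOCR protocols and is attained. Moreover, for every protocol attaining the supremum,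 with entanglement fidelity $E_F$, there is an LOCR superchannel $\Upsilon$, optimal for both $e_{\mathrm{LOCR}}(\mathcal N)$ and $e^F_{\mathrm{LOCR}}(\mathcal N)$, whose simulation channel is $$\Upsilon(\mathcal N)=E_F\,\mathrm{id}^d+(1-E_F)\,\mathcal D,\qquad \mathcal D(\sigma)=\frac1{d^2-1}\sum_{(z,x)\ne(0,0)}W^{z,x}\sigma(W^{z,x})^\dagger,$$ where $z,x\in\{0,\dots,d-1\}$ and $W^{z,x}=Z(z)X(x)$ are the Heisenberg--Weyl operators, $Z(z)=\sum_k e^{2\pi ikz/d}|k\rangle\langle k|$, $X(x)=\sum_k|k+x \bmod d\rangle\langle k|$. (For $d=1$ one has $E_F=1$, and the second term is read as $0$.) -/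

import Mathlib

noncomputable section

open scoped MatrixOrder ComplexOrder

namespace QI

/-- Linear operators on the finite-dimensional Hilbert space `ℂ^a` with orthonormal basis
indexed by `a`. -/
abbrev Op (a : Type*) := Matrix a a ℂ

/-- Linear maps from operators on `ℂ^a` to operators on `ℂ^b`. -/
abbrev SuperOp (a b : Type*) := Op a →ₗ[ℂ] Op b

/-- Density operators: positive semi-definite with unit trace. -/
def IsState {a : Type*} [Fintype a] (ρ : Op a) : Prop :=
  ρ.PosSemidef ∧ ρ.trace = 1

/-- `extend r M` is `id_R ⊗ M`, where `R = ℂ^r` is a reference system. -/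
def extend (r : Type*) {a b : Type*} (M : SuperOp a b) : SuperOp (r × a) (r × b) where
  toFun X := Matrix.of fun i j => M (Matrix.of fun k l => X (i.1, k) (j.1, l)) i.2 j.2
  map_add' X Y := by
    ext i j
    have h : (Matrix.of fun k l => (X + Y) (i.1, k) (j.1, l) : Op a) =
        (Matrix.of fun k l => X (i.1, k) (j.1, l)) + Matrix.of fun k l => Y (i.1, k) (j.1, l) := by
      ext; simp
    rw [Matrix.of_apply, h, map_add]
    rfl
  map_smul' c X := by
    ext i j
    have h : (Matrix.of fun k l => (c • X) (i.1, k) (j.1, l) : Op a) =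
        c • (Matrix.of fun k l => X (i.1, k) (j.1, l)) := by
      ext; simp
    rw [Matrix.of_apply, h, map_smul]
    rfl

/-- Quantum channels: completely positive, trace-preserving maps. -/
structure IsChannel {a b : Type*} [Fintype a] [Fintype b] (M : SuperOp a b) : Prop where
  cp : ∀ (n : ℕ) (X : Op (Fin n × a)), X.PosSemidef → (extend (Fin n) M X).PosSemidef
  tp : ∀ X : Op a, (M X).trace = X.trace

/-- The trace norm `‖X‖₁ = Tr √(X† X)`. -/
def traceNorm {a : Type*} [Fintype a] [DecidableEq a] (X : Op a) : ℝ :=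
  (CFC.sqrt (X.conjTranspose * X)).trace.re

/-- The fidelity `F(ω, τ) = ‖√ω √τ‖₁²` of states. -/
def fidelity {a : Type*} [Fintype a] [DecidableEq a] (ω τ : Op a) : ℝ :=
  traceNorm (CFC.sqrt ω * CFC.sqrt τ) ^ 2

/-- The diamond distance `‖M - M'‖_⋄`: the supremum of `‖(id_R ⊗ M)(ρ) - (id_R ⊗ M')(ρ)‖₁` over
all finite-dimensional reference systems `R` and all bipartite states `ρ`. -/
def diamondDist {a b : Type*} [Fintype a] [Fintype b] [DecidableEq b] (M M' : SuperOp a b) : ℝ :=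
  sSup {t : ℝ | ∃ (n : ℕ) (ρ : Op (Fin n × a)), IsState ρ ∧
    t = traceNorm (extend (Fin n) M ρ - extend (Fin n) M' ρ)}

/-- The channel fidelity: the infimum of `F((id_R ⊗ M)(ρ), (id_R ⊗ M')(ρ))` over
all finite-dimensional reference systems `R` and all bipartite states `ρ`. -/
def channelFidelity {a b : Type*} [Fintype a] [Fintype b] [DecidableEq b]
    (M M' : SuperOp a b) : ℝ :=
  sInf {t : ℝ | ∃ (n : ℕ) (ρ : Op (Fin n × a)), IsState ρ ∧
    t = fidelity (extend (Fin n) M ρ) (extend (Fin n) M' ρ)}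

/-- An LOCR protocol `{(p(y), E^y, D^y)}_y`: a probability distribution on a finite alphabet,
encoding channels from `a` to `a'` and decoding channels from `b'` to `b`. -/
structure LOCRProtocol (a a' b' b : Type*) [Fintype a] [Fintype a'] [Fintype b'] [Fintype b] where
  Y : Type
  [fintypeY : Fintype Y]
  prob : Y → ℝ
  prob_nonneg : ∀ y, 0 ≤ prob y
  prob_sum : ∑ y, prob y = 1
  enc : Y → SuperOp a a'
  enc_channel : ∀ y, IsChannel (enc y)
  dec : Y → SuperOp b' b
  dec_channel : ∀ y, IsChannel (dec y)

attribute [instance] LOCRProtocol.fintypeY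

/-- The LOCR superchannel `M ↦ ∑_y p(y) D^y ∘ M ∘ E^y` of a protocol. -/
def LOCRProtocol.superchannel {a a' b' b : Type*} [Fintype a] [Fintype a'] [Fintype b'] [Fintype b]
    (P : LOCRProtocol a a' b' b) : SuperOp a' b' →ₗ[ℂ] SuperOp a b where
  toFun M := ∑ y, (P.prob y : ℂ) • (P.dec y ∘ₗ M ∘ₗ P.enc y)
  map_add' M M' := by
    simp only [LinearMap.add_comp, LinearMap.comp_add, smul_add, Finset.sum_add_distrib]
  map_smul' c M := by
    simp only [LinearMap.smul_comp, LinearMap.comp_smul, Finset.smul_sum, smul_comm c,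
      RingHom.id_apply]

/-- The set of all LOCR superchannels. -/
def LOCR (a a' b' b : Type*) [Fintype a] [Fintype a'] [Fintype b'] [Fintype b] :
    Set (SuperOp a' b' →ₗ[ℂ] SuperOp a b) :=
  Set.range LOCRProtocol.superchannel

section Simulation

variable {a a' b' : Type*} [Fintype a] [DecidableEq a]

/-- Normalized diamond distance between the identity channel and the simulation `Υ(N)`. -/
def simError (N : SuperOp a' b') (Υ : SuperOp a' b' →ₗ[ℂ] SuperOp a a) : ℝ :=
  1 / 2 * diamondDist LinearMap.id (Υ N)

/-- Channel infidelity between the identity channel and the simulation `Υ(N)`. -/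
def simErrorF (N : SuperOp a' b') (Υ : SuperOp a' b' →ₗ[ℂ] SuperOp a a) : ℝ :=
  1 - channelFidelity LinearMap.id (Υ N)

variable [Fintype a'] [Fintype b']

/-- The LOCR simulation error of `N` with respect to the normalized diamond distance, when
simulating the identity channel on `ℂ^a`. -/
def eLOCR (a : Type*) [Fintype a] [DecidableEq a] (N : SuperOp a' b') : ℝ :=
  sInf (simError N '' LOCR a a' b' a)

/-- The LOCR simulation error of `N` with respect to the channel infidelity, when
simulating the identity channel on `ℂ^a`. -/
def eLOCRF (a : Type*) [Fintype a] [DecidableEq a] (N : SuperOp a' b') : ℝ :=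
  sInf (simErrorF N '' LOCR a a' b' a)

/-- The maximally entangled state `Φ = (1/d) ∑_{i,j} |i⟩⟨j| ⊗ |i⟩⟨j|`, with `d = |a|`. -/
def maxEntangled (a : Type*) [Fintype a] [DecidableEq a] : Op (a × a) :=
  (1 / (Fintype.card a : ℂ)) •
    ∑ i : a, ∑ j : a, Matrix.kronecker (Matrix.single i j 1) (Matrix.single i j 1)

/-- The entanglement fidelity `∑_y p(y) Tr[Φ (id ⊗ D^y ∘ N ∘ E^y)(Φ)]` of a protocol. -/
def entFidelity (N : SuperOp a' b') (P : LOCRProtocol a a' b' a) : ℝ :=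
  ∑ y, P.prob y *
    (maxEntangled a * extend a (P.dec y ∘ₗ N ∘ₗ P.enc y) (maxEntangled a)).trace.re

end Simulation

/-- `Z(z) = ∑_k exp(2πi k z / d) |k⟩⟨k|`. -/
def clockZ {d : ℕ} (z : Fin d) : Op (Fin d) :=
  Matrix.diagonal fun k =>
    Complex.exp (2 * Real.pi * Complex.I * ((k : ℕ) : ℂ) * ((z : ℕ) : ℂ) / (d : ℂ))

/-- `X(x) = ∑_k |k + x mod d⟩⟨k|` (addition in `Fin d` is modulo `d`). -/
def shiftX {d : ℕ} (x : Fin d) : Op (Fin d) :=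
  ∑ k : Fin d, Matrix.single (k + x) k 1

/-- The Heisenberg-Weyl operators `W^{z,x} = Z(z) X(x)`. -/
def heisenbergWeyl {d : ℕ} (z x : Fin d) : Op (Fin d) :=
  clockZ z * shiftX x

/-- The map `σ ↦ W σ W†`. -/
def conjBy {a : Type*} [Fintype a] (W : Op a) : SuperOp a a where
  toFun σ := W * σ * W.conjTranspose
  map_add' σ τ := by simp [mul_add, add_mul]
  map_smul' c σ := by simp

/-- The randomizing map `σ ↦ (1/(d² - 1)) ∑_{(z,x) ≠ (0,0)} W^{z,x} σ (W^{z,x})†`.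
It is a channel for `d ≥ 2`; for `d = 1` the sum is empty and the map is zero. -/
def randomizing (d : ℕ) [NeZero d] : SuperOp (Fin d) (Fin d) :=
  (1 / ((d : ℂ) ^ 2 - 1)) •
    ∑ w ∈ (Finset.univ : Finset (Fin d × Fin d)).erase (0, 0), conjBy (heisenbergWeyl w.1 w.2)

end QI

end

open QI

/-!
For a map `M` on `d × d` matrices the entanglement fidelity is `LinearMap.trace M / d²`
(`trace_maxEntangled_mul_extend`), so it is linear in `M` and unchanged when `M` is replaced by
`U† M(U · U†) U`.

*Lower bound.* Feeding the maximally entangled state into `id` and `M` shows that both the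
normalized diamond distance and the infidelity are at least one minus the entanglement fidelity of
`M` (`one_sub_entanglementFidelity_le_diamondDist`, `one_sub_entanglementFidelity_le_infidelity`).

*Upper bound.* If `M = E id + R` with `R` completely positive, both errors are at most `1 - E`
(`diamondDist_id_le`, `infidelity_id_le`). The second bound holds for arbitrary, also mixed, input
states because the square root is operator monotone. It remains to bring a simulated channel into
this form with `E` equal to its entanglement fidelity. LOCR protocols are closed under local
unitaries and under mixing, hence under twirling. Averaging over monomial unitaries with phases in
the fourth roots of unity leaves `α id + β Δ + γ Tr(·) 1`, with `Δ` the dephasing map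
(`exists_twirl_eq`). Rotating by the Fourier matrix and averaging again replaces the coefficient of
`Δ` by `-β / d`, so a mixture of the two twirls in proportion `1 : d` has none
(`exists_isotropic_mem_simulable`). This finite twirl works in every dimension. Since
`d Tr(·) 1` is the sum of all Heisenberg–Weyl conjugations, the resulting isotropic channel is
`E id + (1 - E) D`, where trace preservation and the invariant entanglement fidelity fix `E`
(`isotropic_mem_simulable`).

*Attainment.* The entanglement fidelity of a protocol is an average over its shared randomness, so
it suffices to maximize over a single encoder and decoder. Their Choi matrices range over compact
sets (`isCompact_choi_channels`) on which the fidelity is continuous.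
-/

noncomputable section

open scoped MatrixOrder ComplexOrder

namespace QI

/-! ### Trace norm and fidelity -/

section TraceNorm

theorem trace_re_nonneg {n : Type*} [Fintype n] {A : Op n} (hA : A.PosSemidef) :
    0 ≤ A.trace.re :=
  (Complex.le_def.mp hA.trace_nonneg).1

variable {n : Type*} [Fintype n] [DecidableEq n]

theorem sqrt_posSemidef (A : Op n) : (CFC.sqrt A).PosSemidef :=
  Matrix.nonneg_iff_posSemidef.mp (CFC.sqrt_nonneg A)

theorem sqrt_mul_sqrt {A : Op n} (hA : A.PosSemidef) : CFC.sqrt A * CFC.sqrt A = A :=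
  CFC.sqrt_mul_sqrt_self A (Matrix.nonneg_iff_posSemidef.mpr hA)

theorem sqrt_eq_of_mul_self {A B : Op n} (h : B * B = A) (hB : B.PosSemidef) :
    CFC.sqrt A = B :=
  CFC.sqrt_unique h (Matrix.nonneg_iff_posSemidef.mpr hB)

theorem trace_unitary_conj {U : Op n} (hU : U * U.conjTranspose = 1) (X : Op n) :
    (U.conjTranspose * X * U).trace = X.trace := by
  rw [Matrix.trace_mul_comm, ← Matrix.mul_assoc, hU, Matrix.one_mul]

/-- The spectral theorem, in terms of plain matrix products. -/
theorem exists_diagonalization {A : Op n} (hA : A.IsHermitian) :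
    ∃ (U : Op n) (ev : n → ℝ), U.conjTranspose * U = 1 ∧ U * U.conjTranspose = 1 ∧
      A = U * Matrix.diagonal (fun i => (ev i : ℂ)) * U.conjTranspose := by
  refine ⟨hA.eigenvectorUnitary, hA.eigenvalues, ?_, ?_, ?_⟩
  · exact Unitary.coe_star_mul_self hA.eigenvectorUnitary
  · exact Unitary.coe_mul_star_self hA.eigenvectorUnitary
  · conv_lhs => rw [hA.spectral_theorem]
    rfl

/-- In an eigenbasis `u` of `|X| = √(X† X)` the vector `X u_i` has length equal to the `i`-th
eigenvalue of `|X|`, which therefore bounds `⟨u_i, X u_i⟩`. -/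
theorem trace_re_le_traceNorm (X : Op n) : X.trace.re ≤ traceNorm X := by
  set P := CFC.sqrt (X.conjTranspose * X) with hP
  have hPpsd : P.PosSemidef := sqrt_posSemidef _
  have hPP : P * P = X.conjTranspose * X :=
    sqrt_mul_sqrt (Matrix.posSemidef_conjTranspose_mul_self X)
  obtain ⟨U, ev, hU1, hU2, hdiag⟩ := exists_diagonalization hPpsd.isHermitian
  have hev : U.conjTranspose * P * U = Matrix.diagonal (fun i => (ev i : ℂ)) := by
    rw [hdiag]
    simp only [Matrix.mul_assoc, hU1, Matrix.mul_one]
    rw [← Matrix.mul_assoc, hU1, Matrix.one_mul]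
  have hev0 : ∀ i, 0 ≤ ev i := by
    intro i
    have h := (hPpsd.conjTranspose_mul_mul_same U)
    rw [hev] at h
    have := h.diag_nonneg (i := i)
    simpa using this
  set Y := U.conjTranspose * X * U with hY
  have hYY : Y.conjTranspose * Y = Matrix.diagonal (fun i => ((ev i ^ 2 : ℝ) : ℂ)) := by
    have : Y.conjTranspose * Y = (U.conjTranspose * P * U) * (U.conjTranspose * P * U) := by
      have e1 : Y.conjTranspose * Y = U.conjTranspose * X.conjTranspose * (U * U.conjTranspose)
          * X * U := by
        simp [hY, Matrix.mul_assoc, Matrix.conjTranspose_mul]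
      have e2 : (U.conjTranspose * P * U) * (U.conjTranspose * P * U)
          = U.conjTranspose * P * (U * U.conjTranspose) * P * U := by
        simp [Matrix.mul_assoc]
      rw [e1, e2, hU2, Matrix.mul_one, Matrix.mul_one, Matrix.mul_assoc U.conjTranspose P P, hPP]
      simp [Matrix.mul_assoc]
    rw [this, hev, Matrix.diagonal_mul_diagonal]
    congr 1; ext i; push_cast; ring
  have hle : ∀ i, (Y i i).re ≤ ev i := by
    intro i
    have h1 : ∑ k, ‖Y k i‖ ^ 2 = ev i ^ 2 := by
      have := congrFun (congrFun hYY i) i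
      simp only [Matrix.mul_apply, Matrix.conjTranspose_apply, Matrix.diagonal_apply_eq] at this
      have h2 : ∀ k, star (Y k i) * Y k i = ((‖Y k i‖ ^ 2 : ℝ) : ℂ) := fun k => by
        rw [Complex.star_def, Complex.conj_mul']; push_cast; rfl
      simp only [h2] at this
      exact_mod_cast this
    have h2 : ‖Y i i‖ ^ 2 ≤ ev i ^ 2 := by
      rw [← h1]
      exact Finset.single_le_sum (f := fun k => ‖Y k i‖ ^ 2) (fun _ _ => by positivity)
        (Finset.mem_univ i)
    exact (Complex.re_le_norm _).trans (abs_le_of_sq_le_sq' h2 (hev0 i)).2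
  have hXt : X.trace = Y.trace := (trace_unitary_conj hU2 X).symm
  have hPt : P.trace.re = ∑ i, ev i := by
    rw [← trace_unitary_conj hU2 P, hev, Matrix.trace_diagonal]
    simp
  rw [traceNorm, ← hP, hPt, hXt, Matrix.trace, Complex.re_sum]
  exact Finset.sum_le_sum fun i _ => hle i

/-- In an eigenbasis of `A - B`, the modulus of each eigenvalue is at most the sum of the
corresponding diagonal entries of `A` and `B`. -/
theorem traceNorm_sub_le {A B : Op n} (hA : A.PosSemidef) (hB : B.PosSemidef) :
    traceNorm (A - B) ≤ A.trace.re + B.trace.re := by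
  have hH : (A - B).IsHermitian := hA.isHermitian.sub hB.isHermitian
  obtain ⟨U, ev, hU1, hU2, hdiag⟩ := exists_diagonalization hH
  have hsq : CFC.sqrt ((A - B).conjTranspose * (A - B))
      = U * Matrix.diagonal (fun i => ((|ev i| : ℝ) : ℂ)) * U.conjTranspose := by
    apply sqrt_eq_of_mul_self
    · rw [hH.eq]
      have key : ∀ D : Op n, (U * D * U.conjTranspose) * (U * D * U.conjTranspose)
          = U * (D * D) * U.conjTranspose := by
        intro D
        have : (U * D * U.conjTranspose) * (U * D * U.conjTranspose)
          = U * D * (U.conjTranspose * U) * D * U.conjTranspose := by simp [Matrix.mul_assoc]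
        rw [this, hU1]; simp [Matrix.mul_assoc]
      rw [hdiag, key, key]
      congr 2
      rw [Matrix.diagonal_mul_diagonal, Matrix.diagonal_mul_diagonal]
      congr 1; ext i
      rw [← Complex.ofReal_mul, ← Complex.ofReal_mul, abs_mul_abs_self]
    · refine Matrix.PosSemidef.mul_mul_conjTranspose_same (Matrix.PosSemidef.diagonal ?_) U
      intro i
      simp
  have hev : U.conjTranspose * (A - B) * U = Matrix.diagonal (fun i => (ev i : ℂ)) := by
    rw [hdiag]
    simp only [Matrix.mul_assoc, hU1, Matrix.mul_one]
    rw [← Matrix.mul_assoc, hU1, Matrix.one_mul]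
  have hA' := hA.conjTranspose_mul_mul_same U
  have hB' := hB.conjTranspose_mul_mul_same U
  have hle : ∀ i, |ev i| ≤ ((U.conjTranspose * A * U) i i).re + ((U.conjTranspose * B * U) i i).re := by
    intro i
    have h1 := (Complex.le_def.mp (hA'.diag_nonneg (i := i))).1
    have h2 := (Complex.le_def.mp (hB'.diag_nonneg (i := i))).1
    have h3 := congrArg Complex.re (congrFun (congrFun hev i) i)
    rw [Matrix.mul_sub, Matrix.sub_mul] at h3
    simp only [Matrix.sub_apply, Complex.sub_re, Matrix.diagonal_apply_eq, Complex.ofReal_re] at h3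
    simp only [Complex.zero_re] at h1 h2
    rw [abs_le]; constructor <;> linarith
  rw [traceNorm, hsq, Matrix.trace_mul_comm, ← Matrix.mul_assoc, hU1, Matrix.one_mul,
    Matrix.trace_diagonal, ← trace_unitary_conj hU2 A, ← trace_unitary_conj hU2 B, Complex.re_sum,
    Matrix.trace, Matrix.trace, Complex.re_sum, Complex.re_sum, ← Finset.sum_add_distrib]
  exact Finset.sum_le_sum fun i _ => by simpa using hle i

/-- The projection `Q` as a test: for `H` of trace zero, `Tr(Q H) ≤ ½ ‖H‖₁`. -/
theorem projection_trace_sub_le_traceNorm {Q : Op n} (hQ : Q.IsHermitian) (hQQ : Q * Q = Q) (H : Op n) :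
    2 * (Q * H).trace.re - H.trace.re ≤ traceNorm H := by
  -- The reflection `2Q - 1` is unitary, so multiplying by it preserves the trace norm.
  set C : Op n := Q + Q - 1 with hC
  have hCC : C.conjTranspose * C = 1 := by
    have : C.conjTranspose = C := by
      simp [hC, Matrix.conjTranspose_add, Matrix.conjTranspose_sub, hQ.eq]
    rw [this, hC]
    simp only [Matrix.sub_mul, Matrix.mul_sub, Matrix.add_mul, Matrix.mul_add, hQQ, Matrix.one_mul,
      Matrix.mul_one]
    abel
  have h1 : traceNorm (C * H) = traceNorm H := by
    have : (C * H).conjTranspose * (C * H) = H.conjTranspose * H := by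
      rw [Matrix.conjTranspose_mul, Matrix.mul_assoc, ← Matrix.mul_assoc _ C H, hCC, Matrix.one_mul]
    rw [traceNorm, traceNorm, this]
  have h2 := trace_re_le_traceNorm (C * H)
  rw [h1, hC, Matrix.sub_mul, Matrix.add_mul, Matrix.one_mul, Matrix.trace_sub, Matrix.trace_add,
    Complex.sub_re, Complex.add_re] at h2
  linarith

open scoped Matrix.Norms.L2Operator in
/-- Operator monotonicity of the square root. The C⋆-norm only serves to invoke the general result:
its topology is the one already carried by matrices. -/
theorem sqrt_mono {A B : Op n} (h : (B - A).PosSemidef) :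
    (CFC.sqrt B - CFC.sqrt A).PosSemidef :=
  Matrix.le_iff.mp (CFC.sqrt_le_sqrt A B (Matrix.le_iff.mpr h))

/-- From `τ ≥ E ρ` follows `√τ ≥ √E √ρ`, hence `‖√ρ √τ‖₁ ≥ Tr(√ρ √τ) ≥ √E`; no purity of `ρ` is
needed. -/
theorem le_fidelity {ρ τ : Op n} (hρ : IsState ρ) {E : ℝ} (hE : 0 ≤ E)
    (h : (τ - (E : ℂ) • ρ).PosSemidef) : E ≤ fidelity ρ τ := by
  have h1 : CFC.sqrt ((E : ℂ) • ρ) = (Real.sqrt E : ℂ) • CFC.sqrt ρ := by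
    apply sqrt_eq_of_mul_self
    · rw [Matrix.smul_mul, Matrix.mul_smul, smul_smul, sqrt_mul_sqrt hρ.1, ← Complex.ofReal_mul,
        Real.mul_self_sqrt hE]
    · exact (sqrt_posSemidef ρ).smul (by simp)
  have h2 := sqrt_mono h
  rw [h1] at h2
  have h3 : 0 ≤ (CFC.sqrt ρ * (CFC.sqrt τ - (Real.sqrt E : ℂ) • CFC.sqrt ρ)).trace.re := by
    set S := CFC.sqrt (CFC.sqrt ρ) with hS
    have hSS : S * S = CFC.sqrt ρ := sqrt_mul_sqrt (sqrt_posSemidef ρ)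
    have hSh : S.conjTranspose = S := (sqrt_posSemidef _).isHermitian
    rw [← hSS, Matrix.mul_assoc, Matrix.trace_mul_comm]
    refine trace_re_nonneg ?_
    rw [hSS]
    have := h2.mul_mul_conjTranspose_same S
    rwa [hSh] at this
  rw [Matrix.mul_sub, Matrix.mul_smul, sqrt_mul_sqrt hρ.1, Matrix.trace_sub, Matrix.trace_smul,
    hρ.2] at h3
  simp only [smul_eq_mul, mul_one, Complex.sub_re, Complex.ofReal_re] at h3
  have h4 := trace_re_le_traceNorm (CFC.sqrt ρ * CFC.sqrt τ)
  have h5 : Real.sqrt E ≤ traceNorm (CFC.sqrt ρ * CFC.sqrt τ) := by linarith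
  calc E = Real.sqrt E ^ 2 := (Real.sq_sqrt hE).symm
    _ ≤ _ := by rw [fidelity]; gcongr

/-- The fidelity with a pure state `|φ⟩⟨φ|` is at most the overlap `⟨φ|τ|φ⟩`. -/
theorem fidelity_pure_le {φ : n → ℂ} (hφ : star φ ⬝ᵥ φ = 1) {τ : Op n} (hτ : τ.PosSemidef) :
    fidelity (Matrix.vecMulVec φ (star φ)) τ ≤ (Matrix.vecMulVec φ (star φ) * τ).trace.re := by
  set Q : Op n := Matrix.vecMulVec φ (star φ) with hQ
  have hQpsd : Q.PosSemidef := Matrix.posSemidef_vecMulVec_self_star φ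
  have hQQ : Q * Q = Q := by
    rw [hQ, Matrix.vecMulVec_mul_vecMulVec, hφ, one_smul]
  have hsQ : CFC.sqrt Q = Q := sqrt_eq_of_mul_self hQQ hQpsd
  set S := CFC.sqrt τ with hS
  have hSh : S.conjTranspose = S := (sqrt_posSemidef _).isHermitian
  have hSS : S * S = τ := sqrt_mul_sqrt hτ
  set t : ℂ := (Q * τ).trace with ht
  have htr : (S * Q * S).trace = t := by
    rw [Matrix.trace_mul_comm, ← Matrix.mul_assoc, hSS, Matrix.trace_mul_comm]
  have hA : (S * Q * S).PosSemidef := by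
    have := hQpsd.mul_mul_conjTranspose_same S
    rwa [hSh] at this
  have ht0 : 0 ≤ t := htr ▸ hA.trace_nonneg
  obtain ⟨ht1, ht2⟩ := Complex.le_def.mp ht0
  simp only [Complex.zero_re, Complex.zero_im] at ht1 ht2
  have htre : t = (t.re : ℂ) := Complex.ext rfl (by simp [← ht2])
  have hQtQ : Q * τ * Q = t • Q := by
    rw [ht, hQ, Matrix.vecMulVec_mul, Matrix.vecMulVec_mul_vecMulVec, Matrix.trace_vecMulVec,
      dotProduct_comm, Matrix.vecMulVec_smul]
  -- `√τ Q √τ` has rank one, so its square is a multiple of it and its root is explicit.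
  have hmul : (S * Q * S) * (S * Q * S) = t • (S * Q * S) := by
    have : (S * Q * S) * (S * Q * S) = S * (Q * (S * S) * Q) * S := by simp [Matrix.mul_assoc]
    rw [this, hSS, hQtQ, Matrix.mul_smul, Matrix.smul_mul]
  have hXX : (Q * S).conjTranspose * (Q * S) = S * Q * S := by
    rw [Matrix.conjTranspose_mul, hSh, hQpsd.isHermitian.eq, Matrix.mul_assoc,
      ← Matrix.mul_assoc Q Q S, hQQ, Matrix.mul_assoc]
  rw [fidelity, hsQ, traceNorm, hXX]
  rcases ht1.eq_or_lt with h0 | hpos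
  · have : S * Q * S = 0 := by
      rw [← hA.trace_eq_zero_iff, htr, htre, ← h0]; simp
    rw [this, CFC.sqrt_zero]
    simp [← h0]
  · have hsq : 0 < Real.sqrt t.re := Real.sqrt_pos.mpr hpos
    have : CFC.sqrt (S * Q * S) = (((Real.sqrt t.re)⁻¹ : ℝ) : ℂ) • (S * Q * S) := by
      apply sqrt_eq_of_mul_self
      · rw [Matrix.smul_mul, Matrix.mul_smul, smul_smul, hmul, smul_smul]
        conv_rhs => rw [← one_smul ℂ (S * Q * S)]
        congr 1
        rw [htre, Complex.ofReal_re, ← Complex.ofReal_mul, ← Complex.ofReal_mul,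
          ← mul_inv, Real.mul_self_sqrt ht1, inv_mul_cancel₀ hpos.ne', Complex.ofReal_one]
      · exact hA.smul (by rw [Complex.zero_le_real]; positivity)
    rw [this, Matrix.trace_smul, htr, smul_eq_mul, Complex.re_ofReal_mul, mul_pow, inv_pow,
      Real.sq_sqrt ht1, sq, inv_mul_cancel_left₀ hpos.ne']

end TraceNorm

/-! ### Completely positive maps and channels -/

section Extend

variable {a b c : Type*}

theorem extend_apply (r : Type*) (M : SuperOp a b) (X : Op (r × a)) (i j : r × b) :
    extend r M X i j = M (Matrix.of fun k l => X (i.1, k) (j.1, l)) i.2 j.2 := rfl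

theorem extend_id (r : Type*) : extend r (LinearMap.id : SuperOp a a) = LinearMap.id := rfl

theorem extend_add (r : Type*) (M M' : SuperOp a b) :
    extend r (M + M') = extend r M + extend r M' := rfl

theorem extend_zero (r : Type*) : extend r (0 : SuperOp a b) = 0 := rfl

theorem extend_sum (r : Type*) {ι : Type*} (s : Finset ι) (M : ι → SuperOp a b) :
    extend r (∑ i ∈ s, M i) = ∑ i ∈ s, extend r (M i) := by
  classical
  induction s using Finset.induction_on with
  | empty => simp [extend_zero]
  | insert i s hi ih => rw [Finset.sum_insert hi, Finset.sum_insert hi, extend_add, ih]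

theorem trace_extend {r : Type*} [Fintype r] [Fintype a] [Fintype b] {M : SuperOp a b}
    (hM : ∀ X : Op a, (M X).trace = X.trace) (X : Op (r × a)) :
    (extend r M X).trace = X.trace := by
  simp only [Matrix.trace, Matrix.diag_apply, Fintype.sum_prod_type, extend_apply]
  exact Finset.sum_congr rfl fun i _ => hM (Matrix.of fun k l => X (i, k) (i, l))

theorem extend_conjBy {r : Type*} [Fintype r] [DecidableEq r] [Fintype a] (W : Op a)
    (X : Op (r × a)) :
    extend r (conjBy W) X = Matrix.kronecker (1 : Op r) W * X *
      (Matrix.kronecker (1 : Op r) W).conjTranspose := by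
  ext ⟨i, k⟩ ⟨j, l⟩
  simp [extend_apply, conjBy, Matrix.mul_apply, Fintype.sum_prod_type, Matrix.one_apply,
    Finset.sum_ite_eq, ite_mul, apply_ite]

end Extend

/-- Complete positivity, with the reference systems used in `IsChannel`. -/
def IsCP {a b : Type*} (M : SuperOp a b) : Prop :=
  ∀ (n : ℕ) (X : Op (Fin n × a)), X.PosSemidef → (extend (Fin n) M X).PosSemidef

section CP

variable {a b c : Type*}

theorem IsCP.comp {M : SuperOp b c} {M' : SuperOp a b} (hM : IsCP M) (hM' : IsCP M') :
    IsCP (M ∘ₗ M') := fun n X hX => hM n _ (hM' n X hX)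

theorem IsCP.smul {M : SuperOp a b} (hM : IsCP M) {t : ℂ} (ht : 0 ≤ t) : IsCP (t • M) :=
  fun n X hX => (hM n X hX).smul ht

theorem IsCP.sum {ι : Type*} (s : Finset ι) {M : ι → SuperOp a b} (hM : ∀ i ∈ s, IsCP (M i)) :
    IsCP (∑ i ∈ s, M i) := by
  intro n X hX
  rw [extend_sum, LinearMap.sum_apply]
  exact Matrix.posSemidef_sum s fun i hi => hM i hi n X hX

theorem IsCP.conjBy [Fintype a] (W : Op a) : IsCP (conjBy W) := by
  intro n X hX
  rw [extend_conjBy]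
  exact hX.mul_mul_conjTranspose_same _

variable [Fintype a] [Fintype b] [Fintype c]

theorem IsChannel.comp {M : SuperOp b c} {M' : SuperOp a b} (hM : IsChannel M)
    (hM' : IsChannel M') : IsChannel (M ∘ₗ M') where
  cp := IsCP.comp hM.cp hM'.cp
  tp X := by rw [LinearMap.comp_apply, hM.tp, hM'.tp]

theorem IsChannel.convexSum {ι : Type*} [Fintype ι] {p : ι → ℝ} (hp : ∀ i, 0 ≤ p i)
    (hp1 : ∑ i, p i = 1) {M : ι → SuperOp a b} (hM : ∀ i, IsChannel (M i)) :
    IsChannel (∑ i, (p i : ℂ) • M i) where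
  cp := IsCP.sum _ fun i _ => IsCP.smul (hM i).cp (Complex.zero_le_real.mpr (hp i))
  tp X := by
    simp only [LinearMap.sum_apply, LinearMap.smul_apply, Matrix.trace_sum, Matrix.trace_smul,
      (hM _).tp, smul_eq_mul, ← Finset.sum_mul]
    rw [← Complex.ofReal_sum, hp1, Complex.ofReal_one, one_mul]

theorem IsChannel.conjBy [DecidableEq a] {U : Op a} (hU : U.conjTranspose * U = 1) :
    IsChannel (conjBy U) where
  cp := IsCP.conjBy U
  tp X := by
    change (U * X * U.conjTranspose).trace = X.trace
    rw [Matrix.trace_mul_comm, ← Matrix.mul_assoc, hU, Matrix.one_mul]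

theorem IsChannel.isState {M : SuperOp a b} (hM : IsChannel M) {n : ℕ} {ρ : Op (Fin n × a)}
    (hρ : IsState ρ) : IsState (extend (Fin n) M ρ) :=
  ⟨hM.cp n ρ hρ.1, by rw [trace_extend hM.tp, hρ.2]⟩

/-- Discarding the input and preparing a fixed basis state is a channel. -/
theorem exists_isChannel (a b : Type*) [Fintype a] [Fintype b] [Nonempty b] :
    ∃ M : SuperOp a b, IsChannel M := by
  classical
  obtain ⟨k0⟩ := ‹Nonempty b›
  let S : Op b := Matrix.single k0 k0 1
  refine ⟨(Matrix.traceLinearMap a ℂ ℂ).smulRight S, ?_, ?_⟩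
  · intro n X hX
    have hS : S.PosSemidef := by
      have : S = Matrix.diagonal (Pi.single k0 1) := (Matrix.diagonal_single k0 1).symm
      rw [this]
      exact Matrix.PosSemidef.diagonal (Pi.single_nonneg.mpr zero_le_one)
    have : extend (Fin n) ((Matrix.traceLinearMap a ℂ ℂ).smulRight S) X =
        ∑ k : a, Matrix.kronecker (X.submatrix (fun i : Fin n => (i, k)) fun i => (i, k)) S := by
      ext ⟨i, k⟩ ⟨j, l⟩
      simp [extend_apply, Matrix.trace, Matrix.sum_apply, Finset.sum_mul]
    rw [this]
    exact Matrix.posSemidef_sum _ fun k _ => (hX.submatrix _).kronecker hS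
  · intro X
    simp [S]

end CP

/-! ### Simulable channels -/

section Simulable

variable {a a' b' b : Type*} [Fintype a] [Fintype a'] [Fintype b'] [Fintype b]

/-- The channels that LOCR protocols simulate with the help of `N`. -/
def simulable (a b : Type*) [Fintype a] [Fintype b] (N : SuperOp a' b') : Set (SuperOp a b) :=
  {M | ∃ P : LOCRProtocol a a' b' b, P.superchannel N = M}

theorem superchannel_apply (P : LOCRProtocol a a' b' b) (N : SuperOp a' b') :
    P.superchannel N = ∑ y, (P.prob y : ℂ) • (P.dec y ∘ₗ N ∘ₗ P.enc y) := rfl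

theorem isChannel_of_mem_simulable {N : SuperOp a' b'} (hN : IsChannel N) {M : SuperOp a b}
    (hM : M ∈ simulable a b N) : IsChannel M := by
  obtain ⟨P, rfl⟩ := hM
  exact IsChannel.convexSum P.prob_nonneg P.prob_sum fun y =>
    (P.dec_channel y).comp (hN.comp (P.enc_channel y))

/-- Local channels can be absorbed into the encoders and decoders. -/
theorem comp_mem_simulable {N : SuperOp a' b'} {M : SuperOp a b} (hM : M ∈ simulable a b N)
    {A : SuperOp a a} {B : SuperOp b b} (hA : IsChannel A) (hB : IsChannel B) :
    B ∘ₗ M ∘ₗ A ∈ simulable a b N := by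
  obtain ⟨P, rfl⟩ := hM
  refine ⟨⟨P.Y, P.prob, P.prob_nonneg, P.prob_sum, fun y => P.enc y ∘ₗ A,
    fun y => (P.enc_channel y).comp hA, fun y => B ∘ₗ P.dec y,
    fun y => hB.comp (P.dec_channel y)⟩, ?_⟩
  rw [superchannel_apply, superchannel_apply]
  ext1 X
  simp [LinearMap.sum_apply]

/-- The shared randomness can also select which protocol to run. -/
theorem convexSum_mem_simulable {N : SuperOp a' b'} {ι : Type} [Fintype ι] {p : ι → ℝ}
    (hp : ∀ i, 0 ≤ p i) (hp1 : ∑ i, p i = 1) {M : ι → SuperOp a b}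
    (hM : ∀ i, M i ∈ simulable a b N) :
    ∑ i, (p i : ℂ) • M i ∈ simulable a b N := by
  choose P hP using hM
  refine ⟨⟨Σ i, (P i).Y, fun y => p y.1 * (P y.1).prob y.2,
    fun y => mul_nonneg (hp _) ((P y.1).prob_nonneg _), ?_, fun y => (P y.1).enc y.2,
    fun y => (P y.1).enc_channel _, fun y => (P y.1).dec y.2,
    fun y => (P y.1).dec_channel _⟩, ?_⟩
  · rw [Fintype.sum_sigma]
    simp only [← Finset.mul_sum, (P _).prob_sum, mul_one, hp1]
  · rw [superchannel_apply, Fintype.sum_sigma]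
    refine Finset.sum_congr rfl fun i _ => ?_
    rw [← hP i, superchannel_apply, Finset.smul_sum]
    refine Finset.sum_congr rfl fun y _ => ?_
    rw [smul_smul, Complex.ofReal_mul]

end Simulable

/-! ### Entanglement fidelity of a channel -/

section EntFidelity

variable {a : Type*} [Fintype a] [DecidableEq a]

theorem maxEntangled_apply (i k j l : a) : maxEntangled a (i, k) (j, l) =
    if i = k ∧ j = l then 1 / (Fintype.card a : ℂ) else 0 := by
  simp only [maxEntangled, Matrix.smul_apply, Matrix.sum_apply, smul_eq_mul]
  rw [Finset.sum_eq_single i, Finset.sum_eq_single j]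
  · by_cases h1 : i = k <;> by_cases h2 : j = l <;> simp [h1, h2]
  · intro p _ hp; simp [hp]
  · simp
  · intro p _ hp; simp [hp]
  · simp

/-- The maximally entangled unit vector, whose projection is `maxEntangled`. -/
def maxEntangledVec (a : Type*) [Fintype a] [DecidableEq a] : a × a → ℂ :=
  fun i => if i.1 = i.2 then (((Real.sqrt (Fintype.card a))⁻¹ : ℝ) : ℂ) else 0

theorem maxEntangled_eq_vecMulVec :
    maxEntangled a = Matrix.vecMulVec (maxEntangledVec a) (star (maxEntangledVec a)) := by
  ext ⟨i, k⟩ ⟨j, l⟩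
  rw [maxEntangled_apply, Matrix.vecMulVec_apply, Pi.star_apply]
  by_cases h1 : i = k <;> by_cases h2 : j = l <;> simp [maxEntangledVec, h1, h2]
  rw [← mul_inv, ← Complex.ofReal_mul, Real.mul_self_sqrt (by positivity)]
  simp

theorem maxEntangledVec_unit [Nonempty a] :
    star (maxEntangledVec a) ⬝ᵥ maxEntangledVec a = 1 := by
  have hd : (0 : ℝ) < Fintype.card a := by exact_mod_cast Fintype.card_pos
  simp only [dotProduct, Fintype.sum_prod_type, Pi.star_apply, maxEntangledVec]
  simp
  rw [← mul_inv, ← Complex.ofReal_mul, Real.mul_self_sqrt hd.le]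
  field_simp
  simp

theorem maxEntangled_isState [Nonempty a] : IsState (maxEntangled a) := by
  rw [maxEntangled_eq_vecMulVec]
  exact ⟨Matrix.posSemidef_vecMulVec_self_star _, by
    rw [Matrix.trace_vecMulVec, dotProduct_comm, maxEntangledVec_unit]⟩

theorem maxEntangled_mul_self [Nonempty a] : maxEntangled a * maxEntangled a = maxEntangled a := by
  rw [maxEntangled_eq_vecMulVec, Matrix.vecMulVec_mul_vecMulVec, maxEntangledVec_unit, one_smul]

/-- The entanglement fidelity `Tr[Φ (id ⊗ M)(Φ)]` of a map `M`. -/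
def entanglementFidelity (M : SuperOp a a) : ℝ :=
  (maxEntangled a * extend a M (maxEntangled a)).trace.re

theorem trace_superOp (M : SuperOp a a) :
    LinearMap.trace ℂ (Op a) M = ∑ i, ∑ j, M (Matrix.single i j 1) i j := by
  rw [LinearMap.trace_eq_matrix_trace ℂ (Matrix.stdBasis ℂ a a), Matrix.trace,
    Fintype.sum_prod_type]
  refine Finset.sum_congr rfl fun i _ => Finset.sum_congr rfl fun j _ => ?_
  rw [Matrix.diag_apply, LinearMap.toMatrix_apply, Matrix.stdBasis_eq_single]
  rfl

/-- The entanglement fidelity is, up to `d²`, the trace of `M` as an endomorphism of the matrix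
space. This makes it linear in `M` and invariant under conjugation. -/
theorem trace_maxEntangled_mul_extend (M : SuperOp a a) :
    (maxEntangled a * extend a M (maxEntangled a)).trace =
      LinearMap.trace ℂ (Op a) M / (Fintype.card a : ℂ) ^ 2 := by
  have hext : ∀ i k j l : a, extend a M (maxEntangled a) (i, k) (j, l) =
      1 / (Fintype.card a : ℂ) * M (Matrix.single i j 1) k l := by
    intro i k j l
    have hblock : (Matrix.of fun k l => maxEntangled a (i, k) (j, l)) =
        (1 / (Fintype.card a : ℂ)) • Matrix.single i j 1 := by
      ext k l
      simp [maxEntangled_apply, Matrix.single_apply]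
    rw [extend_apply, hblock, map_smul, Matrix.smul_apply, smul_eq_mul]
  rw [trace_superOp]
  simp only [Matrix.trace, Matrix.diag_apply, Matrix.mul_apply, Fintype.sum_prod_type, hext,
    maxEntangled_apply]
  rw [Finset.sum_comm' (t' := Finset.univ) (s' := fun _ => Finset.univ) (by simp)]
  simp only [ite_and, ite_mul, zero_mul, Finset.sum_ite_eq, Finset.mem_univ, if_true,
    Finset.sum_ite_irrel, Finset.sum_const_zero, Finset.sum_ite_eq', Finset.sum_div]
  rw [Finset.sum_comm]
  refine Finset.sum_congr rfl fun i _ => Finset.sum_congr rfl fun j _ => ?_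
  ring

theorem entanglementFidelity_eq_trace (M : SuperOp a a) :
    entanglementFidelity M = (LinearMap.trace ℂ (Op a) M).re / (Fintype.card a : ℝ) ^ 2 := by
  rw [entanglementFidelity, trace_maxEntangled_mul_extend, ← Complex.ofReal_natCast,
    ← Complex.ofReal_pow, Complex.div_ofReal_re]

theorem entFidelity_eq {a' b' : Type*} [Fintype a'] [Fintype b'] (N : SuperOp a' b')
    (P : LOCRProtocol a a' b' a) : entFidelity N P = entanglementFidelity (P.superchannel N) := by
  simp only [entFidelity, entanglementFidelity, trace_maxEntangled_mul_extend, superchannel_apply,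
    map_sum, map_smul, smul_eq_mul, Finset.sum_div, Complex.re_sum, mul_div_assoc,
    Complex.re_ofReal_mul]

end EntFidelity

/-! ### Simulation errors and entanglement fidelity -/

section Errors

variable {d : ℕ} [NeZero d]

theorem fin_extend_isState {M : SuperOp (Fin d) (Fin d)} (hM : IsChannel M) :
    IsState (extend (Fin d) M (maxEntangled (Fin d))) := hM.isState maxEntangled_isState

theorem entanglementFidelity_mem_Icc {M : SuperOp (Fin d) (Fin d)} (hM : IsChannel M) :
    entanglementFidelity M ∈ Set.Icc (0 : ℝ) 1 := by
  have hτ := fin_extend_isState hM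
  set τ := extend (Fin d) M (maxEntangled (Fin d)) with hτdef
  have hΦ := maxEntangled_isState (a := Fin d)
  set Q := maxEntangled (Fin d) with hQ
  have hQQ : Q * Q = Q := maxEntangled_mul_self
  have key : ∀ R : Op (Fin d × Fin d), R.IsHermitian → R * R = R → 0 ≤ (R * τ).trace.re := by
    intro R hR hRR
    rw [← hRR, Matrix.mul_assoc, Matrix.trace_mul_comm]
    have := hτ.1.mul_mul_conjTranspose_same R
    rw [hR.eq] at this
    exact trace_re_nonneg this
  constructor
  · exact key Q hΦ.1.isHermitian hQQ
  · have h := key (1 - Q) (Matrix.isHermitian_one.sub hΦ.1.isHermitian) (by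
      rw [Matrix.sub_mul, Matrix.mul_sub, Matrix.mul_sub, hQQ]; simp)
    rw [Matrix.sub_mul, Matrix.one_mul, Matrix.trace_sub, hτ.2, Complex.sub_re, Complex.one_re] at h
    exact sub_nonneg.mp h

/-- For a channel the overlap with the maximally entangled state is already real. -/
theorem coe_entanglementFidelity {M : SuperOp (Fin d) (Fin d)} (hM : IsChannel M) :
    (entanglementFidelity M : ℂ) = LinearMap.trace ℂ (Op (Fin d)) M / (d : ℂ) ^ 2 := by
  have hτ := fin_extend_isState hM
  have hΦ := maxEntangled_isState (a := Fin d)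
  have h : 0 ≤ (maxEntangled (Fin d) * extend (Fin d) M (maxEntangled (Fin d))).trace := by
    rw [← maxEntangled_mul_self, Matrix.mul_assoc, Matrix.trace_mul_comm, maxEntangled_mul_self]
    have := hτ.1.mul_mul_conjTranspose_same (maxEntangled (Fin d))
    rw [hΦ.1.isHermitian.eq] at this
    exact this.trace_nonneg
  have h2 := trace_maxEntangled_mul_extend M
  rw [Fintype.card_fin] at h2
  rw [← h2]
  exact Complex.ext rfl (Complex.le_def.mp h).2

theorem bddAbove_diamondDist {a b : Type*} [Fintype a] [Fintype b] [DecidableEq b]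
    {M M' : SuperOp a b} (hM : IsChannel M) (hM' : IsChannel M') :
    BddAbove {t : ℝ | ∃ (n : ℕ) (ρ : Op (Fin n × a)), IsState ρ ∧
      t = traceNorm (extend (Fin n) M ρ - extend (Fin n) M' ρ)} := by
  refine ⟨2, ?_⟩
  rintro t ⟨n, ρ, hρ, rfl⟩
  refine (traceNorm_sub_le (hM.isState hρ).1 (hM'.isState hρ).1).trans ?_
  rw [(hM.isState hρ).2, (hM'.isState hρ).2]
  norm_num

theorem isChannel_id {a : Type*} [Fintype a] : IsChannel (LinearMap.id : SuperOp a a) :=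
  ⟨fun _ _ hX => hX, fun _ => rfl⟩

/-- Lower bound from the maximally entangled input and its own projection as a test. -/
theorem one_sub_entanglementFidelity_le_diamondDist {M : SuperOp (Fin d) (Fin d)}
    (hM : IsChannel M) : 1 - entanglementFidelity M ≤ 1 / 2 * diamondDist LinearMap.id M := by
  have hτ := fin_extend_isState hM
  have hΦ := maxEntangled_isState (a := Fin d)
  have h1 := le_csSup (bddAbove_diamondDist (isChannel_id (a := Fin d)) hM)
    ⟨d, maxEntangled (Fin d), hΦ, rfl⟩
  have h2 := projection_trace_sub_le_traceNorm hΦ.1.isHermitian maxEntangled_mul_self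
    (maxEntangled (Fin d) - extend (Fin d) M (maxEntangled (Fin d)))
  rw [Matrix.mul_sub, maxEntangled_mul_self, Matrix.trace_sub, Matrix.trace_sub, hΦ.2, hτ.2] at h2
  simp only [Complex.sub_re, Complex.one_re, sub_self, Complex.zero_re] at h2
  rw [extend_id, LinearMap.id_apply] at h1
  rw [entanglementFidelity, diamondDist]
  linarith

theorem one_sub_entanglementFidelity_le_infidelity {M : SuperOp (Fin d) (Fin d)}
    (hM : IsChannel M) :
    1 - entanglementFidelity M ≤ 1 - channelFidelity LinearMap.id M := by
  have hτ := fin_extend_isState hM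
  have h1 : channelFidelity LinearMap.id M ≤
      fidelity (maxEntangled (Fin d)) (extend (Fin d) M (maxEntangled (Fin d))) :=
    csInf_le ⟨0, by rintro t ⟨n, ρ, -, rfl⟩; exact sq_nonneg _⟩
      ⟨d, maxEntangled (Fin d), maxEntangled_isState, by rw [extend_id, LinearMap.id_apply]⟩
  have h2 := fidelity_pure_le (maxEntangledVec_unit (a := Fin d)) hτ.1
  rw [← maxEntangled_eq_vecMulVec] at h2
  exact sub_le_sub_left (h1.trans h2) 1

theorem exists_isState (d : ℕ) [NeZero d] :
    ∃ (n : ℕ) (ρ : Op (Fin n × Fin d)), IsState ρ := ⟨d, _, maxEntangled_isState⟩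

/-- The difference `ρ - M(ρ)` is `(1 - E) ρ - R(ρ)`, two positive parts of trace `1 - E` each. -/
theorem diamondDist_id_le {M R : SuperOp (Fin d) (Fin d)} (hM : IsChannel M) (hR : IsCP R)
    {E : ℝ} (hE : E ≤ 1) (h : M = (E : ℂ) • LinearMap.id + R) :
    1 / 2 * diamondDist LinearMap.id M ≤ 1 - E := by
  have : diamondDist LinearMap.id M ≤ 2 * (1 - E) := by
    obtain ⟨n, ρ, hρ⟩ := exists_isState d
    refine csSup_le ⟨_, n, ρ, hρ, rfl⟩ ?_
    rintro t ⟨n, ρ, hρ, rfl⟩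
    have hMρ : extend (Fin n) M ρ = (E : ℂ) • ρ + extend (Fin n) R ρ := by
      rw [h]; rfl
    have htr := (hM.isState hρ).2
    rw [hMρ, Matrix.trace_add, Matrix.trace_smul, hρ.2] at htr
    have htr' := congrArg Complex.re htr
    simp only [smul_eq_mul, mul_one, Complex.add_re, Complex.ofReal_re, Complex.one_re] at htr'
    have heq : extend (Fin n) LinearMap.id ρ - extend (Fin n) M ρ =
        ((1 - E : ℝ) : ℂ) • ρ - extend (Fin n) R ρ := by
      rw [hMρ, extend_id, LinearMap.id_apply, Complex.ofReal_sub, sub_smul, Complex.ofReal_one,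
        one_smul]
      abel
    have hpos : (((1 - E : ℝ) : ℂ) • ρ).PosSemidef :=
      hρ.1.smul (Complex.zero_le_real.mpr (sub_nonneg.mpr hE))
    rw [heq]
    refine (traceNorm_sub_le hpos (hR n ρ hρ.1)).trans ?_
    rw [Matrix.trace_smul, hρ.2, smul_eq_mul, mul_one, Complex.ofReal_re]
    linarith
  linarith

theorem infidelity_id_le {M R : SuperOp (Fin d) (Fin d)} (hR : IsCP R)
    {E : ℝ} (hE : 0 ≤ E) (h : M = (E : ℂ) • LinearMap.id + R) :
    1 - channelFidelity LinearMap.id M ≤ 1 - E := by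
  refine sub_le_sub_left ?_ 1
  obtain ⟨n, ρ, hρ⟩ := exists_isState d
  refine le_csInf ⟨_, n, ρ, hρ, rfl⟩ ?_
  rintro t ⟨n, ρ, hρ, rfl⟩
  refine le_fidelity hρ hE ?_
  have : extend (Fin n) M ρ - (E : ℂ) • ρ = extend (Fin n) R ρ := by
    have : extend (Fin n) M ρ = (E : ℂ) • ρ + extend (Fin n) R ρ := by
      rw [h]; rfl
    rw [this, add_sub_cancel_left]
  rw [this]
  exact hR n ρ hρ.1

end Errors

/-! ### Compactness of the set of channels and existence of an optimal protocol -/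

section Compactness

variable {a b : Type*} [Fintype a]

/-- The linear map whose value on the matrix unit `|i⟩⟨j|` has entries `C i j k l`. The array `C`
is the Choi matrix; its type carries the product topology. -/
def ofChoi (C : a → a → b → b → ℂ) : SuperOp a b where
  toFun X := Matrix.of fun k l => ∑ i, ∑ j, X i j * C i j k l
  map_add' X Y := by
    ext k l
    simp [add_mul, Finset.sum_add_distrib]
  map_smul' t X := by
    ext k l
    simp [Finset.mul_sum, mul_assoc]

theorem ofChoi_apply (C : a → a → b → b → ℂ) (X : Op a) (k l : b) :
    ofChoi C X k l = ∑ i, ∑ j, X i j * C i j k l := rfl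

theorem ofChoi_self [DecidableEq a] (M : SuperOp a b) :
    ofChoi (fun i j k l => M (Matrix.single i j 1) k l) = M := by
  ext X k l
  rw [ofChoi_apply]
  conv_rhs => rw [Matrix.matrix_eq_sum_single X]
  simp only [map_sum, Matrix.sum_apply]
  refine Finset.sum_congr rfl fun i _ => Finset.sum_congr rfl fun j _ => ?_
  have : Matrix.single i j (X i j) = X i j • Matrix.single i j (1 : ℂ) := by
    rw [Matrix.smul_single, smul_eq_mul, mul_one]
  rw [this, map_smul, Matrix.smul_apply, smul_eq_mul]

theorem continuous_ofChoi {T : Type*} [TopologicalSpace T] {C : T → a → a → b → b → ℂ}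
    {X : T → Op a} (hC : Continuous C) (hX : Continuous X) :
    Continuous fun t => ofChoi (C t) (X t) := by
  refine continuous_matrix fun k l => ?_
  simp only [ofChoi_apply]
  refine continuous_finsetSum _ fun i _ => continuous_finsetSum _ fun j _ => ?_
  exact (hX.matrix_elem i j).mul (by fun_prop)

theorem isClosed_posSemidef : IsClosed {A : Op a | A.PosSemidef} := by
  simp only [Matrix.posSemidef_iff_dotProduct_mulVec, Set.ofPred_and, Set.ofPred_forall]
  refine IsClosed.inter (isClosed_eq (by fun_prop) continuous_id) ?_
  refine isClosed_iInter fun x => isClosed_le continuous_const ?_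
  fun_prop

/-- Writing `A = S† S`, the Cauchy–Schwarz inequality bounds an entry of `A` by the mean of two
diagonal entries. -/
theorem norm_apply_le_trace [DecidableEq a] {A : Op a} (hA : A.PosSemidef) (k l : a) :
    ‖A k l‖ ≤ A.trace.re := by
  set S := CFC.sqrt A with hS
  have hSh : S.conjTranspose = S := (sqrt_posSemidef A).isHermitian
  have hSS : S.conjTranspose * S = A := by rw [hSh, sqrt_mul_sqrt hA]
  have hdiag : ∀ i, (A i i).re = ∑ m, ‖S m i‖ ^ 2 := by
    intro i
    rw [← hSS, Matrix.mul_apply, Complex.re_sum]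
    refine Finset.sum_congr rfl fun m _ => ?_
    rw [Matrix.conjTranspose_apply, Complex.star_def, Complex.conj_mul', ← Complex.ofReal_pow,
      Complex.ofReal_re]
  have hle : ∀ i, (A i i).re ≤ A.trace.re := by
    intro i
    rw [Matrix.trace, Complex.re_sum]
    refine Finset.single_le_sum (f := fun i => (A i i).re) (fun j _ => ?_) (Finset.mem_univ i)
    rw [hdiag]
    positivity
  calc ‖A k l‖ = ‖∑ m, star (S m k) * S m l‖ := by
        conv_lhs => rw [← hSS, Matrix.mul_apply]
        rfl
    _ ≤ ∑ m, ‖S m k‖ * ‖S m l‖ := by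
        refine (norm_sum_le _ _).trans_eq ?_
        simp
    _ ≤ ∑ m, (‖S m k‖ ^ 2 + ‖S m l‖ ^ 2) / 2 := by
        refine Finset.sum_le_sum fun m _ => ?_
        nlinarith [sq_nonneg (‖S m k‖ - ‖S m l‖)]
    _ = ((A k k).re + (A l l).re) / 2 := by
        rw [← Finset.sum_div, Finset.sum_add_distrib, hdiag, hdiag]
    _ ≤ A.trace.re := by linarith [hle k, hle l]

/-- The Choi matrices of channels are uniformly bounded, because a Choi matrix is positive
semidefinite with a trace that does not depend on the channel. -/
theorem exists_choi_bound (a b : Type*) [Fintype a] [Fintype b] [DecidableEq a] :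
    ∃ r : ℝ, ∀ M : SuperOp a b, IsChannel M →
      ∀ i j k l, ‖M (Matrix.single i j 1) k l‖ ≤ r := by
  classical
  let e := Fintype.equivFin a
  -- `X` is the unnormalized maximally entangled state; its blocks are the matrix units.
  let v : Fin (Fintype.card a) × a → ℂ := fun p => if p.1 = e p.2 then 1 else 0
  let X : Op (Fin (Fintype.card a) × a) := Matrix.vecMulVec v (star v)
  have hX : X.PosSemidef := Matrix.posSemidef_vecMulVec_self_star v
  refine ⟨X.trace.re, fun M hM i j k l => ?_⟩
  have hblock : (Matrix.of fun p q => X (e i, p) (e j, q)) = Matrix.single i j 1 := by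
    ext p q
    by_cases h1 : i = p <;> by_cases h2 : j = q <;>
      simp [X, v, Matrix.vecMulVec_apply, h1, h2]
  have h := norm_apply_le_trace (hM.cp _ X hX) (e i, k) (e j, l)
  rwa [extend_apply, hblock, trace_extend hM.tp] at h

/-- Complete positivity and trace preservation are closed conditions on the Choi matrix, one for
each input operator, and the Choi matrices of channels are bounded. -/
theorem isCompact_choi_channels [Fintype b] :
    IsCompact {C : a → a → b → b → ℂ | IsChannel (ofChoi C)} := by
  classical
  obtain ⟨r, hr⟩ := exists_choi_bound a b
  have hcpt : IsCompact (Set.univ.pi fun _ : a => Set.univ.pi fun _ : a => Set.univ.pi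
      fun _ : b => Set.univ.pi fun _ : b => Metric.closedBall (0 : ℂ) r) :=
    isCompact_univ_pi fun _ => isCompact_univ_pi fun _ => isCompact_univ_pi fun _ =>
      isCompact_univ_pi fun _ => isCompact_closedBall _ _
  refine hcpt.of_isClosed_subset ?_ ?_
  · have : {C : a → a → b → b → ℂ | IsChannel (ofChoi C)} =
        (⋂ (n : ℕ) (X : Op (Fin n × a)) (_ : X.PosSemidef),
          {C | (extend (Fin n) (ofChoi C) X).PosSemidef}) ∩
        ⋂ X : Op a, {C | (ofChoi C X).trace = X.trace} := by
      ext C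
      simp only [Set.mem_ofPred_eq, Set.mem_inter_iff, Set.mem_iInter]
      exact ⟨fun h => ⟨h.cp, h.tp⟩, fun h => ⟨h.1, h.2⟩⟩
    rw [this]
    refine IsClosed.inter ?_ ?_
    · refine isClosed_iInter fun n => isClosed_iInter fun X => isClosed_iInter fun _ => ?_
      refine isClosed_posSemidef.preimage (continuous_matrix fun i j => ?_)
      exact (continuous_ofChoi continuous_id continuous_const).matrix_elem i.2 j.2
    · refine isClosed_iInter fun X => isClosed_eq ?_ continuous_const
      exact (continuous_ofChoi continuous_id continuous_const).matrix_trace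
  · intro C hC
    simp only [Set.mem_pi, Set.mem_univ, forall_true_left, mem_closedBall_zero_iff]
    intro i j k l
    have h := hr _ hC i j k l
    rw [ofChoi_apply, Finset.sum_eq_single i, Finset.sum_eq_single j] at h
    · simpa using h
    · intro q _ hq; simp [hq.symm]
    · simp
    · intro p _ hp; simp [hp.symm]
    · simp

end Compactness

section Optimal

theorem entanglementFidelity_sum {a ι : Type*} [Fintype a] [DecidableEq a] [Fintype ι] (p : ι → ℝ)
    (M : ι → SuperOp a a) :
    entanglementFidelity (∑ i, (p i : ℂ) • M i) = ∑ i, p i * entanglementFidelity (M i) := by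
  simp only [entanglementFidelity_eq_trace, map_sum, map_smul, smul_eq_mul, Finset.sum_div,
    Complex.re_sum, mul_div_assoc, Complex.re_ofReal_mul]

variable {a a' b' : Type*} [Fintype a] [DecidableEq a] [Nonempty a] [Fintype a'] [Nonempty a']
  [Fintype b']

theorem exists_optimal_coding (N : SuperOp a' b') :
    ∃ (E : SuperOp a a') (D : SuperOp b' a), IsChannel E ∧ IsChannel D ∧
      ∀ (E' : SuperOp a a') (D' : SuperOp b' a), IsChannel E' → IsChannel D' →
        entanglementFidelity (D' ∘ₗ N ∘ₗ E') ≤ entanglementFidelity (D ∘ₗ N ∘ₗ E) := by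
  classical
  have hcpt := (isCompact_choi_channels (a := a) (b := a')).prod
    (isCompact_choi_channels (a := b') (b := a))
  obtain ⟨E₀, hE₀⟩ := exists_isChannel a a'
  obtain ⟨D₀, hD₀⟩ := exists_isChannel b' a
  have hcont : Continuous fun c : (a → a → a' → a' → ℂ) × (b' → b' → a → a → ℂ) =>
      entanglementFidelity (ofChoi c.2 ∘ₗ N ∘ₗ ofChoi c.1) := by
    simp only [entanglementFidelity_eq_trace, trace_superOp, LinearMap.comp_apply]
    refine (Complex.continuous_re.comp ?_).div_const _
    refine continuous_finsetSum _ fun i _ => continuous_finsetSum _ fun j _ => ?_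
    refine Continuous.matrix_elem (continuous_ofChoi continuous_snd ?_) i j
    exact (LinearMap.continuous_of_finiteDimensional N).comp
      (continuous_ofChoi continuous_fst continuous_const)
  obtain ⟨c, hc, hmax⟩ := hcpt.exists_isMaxOn
    ⟨(fun i j k l => E₀ (Matrix.single i j 1) k l, fun i j k l => D₀ (Matrix.single i j 1) k l),
      by simpa [ofChoi_self] using ⟨hE₀, hD₀⟩⟩ hcont.continuousOn
  refine ⟨ofChoi c.1, ofChoi c.2, hc.1, hc.2, fun E' D' hE' hD' => ?_⟩
  have := hmax (a := (fun i j k l => E' (Matrix.single i j 1) k l,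
    fun i j k l => D' (Matrix.single i j 1) k l)) (by simpa [ofChoi_self] using ⟨hE', hD'⟩)
  simpa [ofChoi_self] using this

/-- Shared randomness does not increase the best entanglement fidelity, so an optimal pair of
encoder and decoder is an optimal protocol. -/
theorem exists_optimal_protocol (N : SuperOp a' b') :
    ∃ P : LOCRProtocol a a' b' a, ∀ P' : LOCRProtocol a a' b' a,
      entFidelity N P' ≤ entFidelity N P := by
  obtain ⟨E, D, hE, hD, hmax⟩ := exists_optimal_coding (a := a) N
  refine ⟨⟨Unit, fun _ => 1, fun _ => zero_le_one, by simp, fun _ => E, fun _ => hE, fun _ => D,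
    fun _ => hD⟩, fun P' => ?_⟩
  rw [entFidelity_eq, entFidelity_eq, superchannel_apply, superchannel_apply,
    entanglementFidelity_sum, entanglementFidelity_sum]
  simp only [Finset.univ_unique, Finset.sum_singleton, one_mul]
  calc _ ≤ ∑ y, P'.prob y * entanglementFidelity (D ∘ₗ N ∘ₗ E) :=
        Finset.sum_le_sum fun y _ => mul_le_mul_of_nonneg_left
          (hmax _ _ (P'.enc_channel y) (P'.dec_channel y)) (P'.prob_nonneg y)
    _ = _ := by rw [← Finset.sum_mul, P'.prob_sum, one_mul]

end Optimal

/-! ### Twirling over monomial unitaries -/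

section Twirl

theorem superOp_ext {a b : Type*} [Fintype a] [DecidableEq a] [Fintype b] {M M' : SuperOp a b}
    (h : ∀ i j k l, M (Matrix.single i j 1) k l = M' (Matrix.single i j 1) k l) : M = M' := by
  rw [← ofChoi_self M, ← ofChoi_self M']
  simp only [h]

theorem conjBy_apply {a : Type*} [Fintype a] (W X : Op a) :
    conjBy W X = W * X * W.conjTranspose := rfl

theorem conjBy_one {a : Type*} [Fintype a] [DecidableEq a] :
    conjBy (1 : Op a) = LinearMap.id := by
  ext1 X
  simp [conjBy_apply]

theorem conjBy_comp {a : Type*} [Fintype a] (V W : Op a) :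
    conjBy V ∘ₗ conjBy W = conjBy (V * W) := by
  ext1 X
  simp [conjBy_apply, Matrix.conjTranspose_mul, Matrix.mul_assoc]

/-- The rotated map `σ ↦ U† M(U σ U†) U`. -/
def rotate {a : Type*} [Fintype a] (U : Op a) (M : SuperOp a a) : SuperOp a a :=
  conjBy U.conjTranspose ∘ₗ M ∘ₗ conjBy U

variable {n : Type} [Fintype n] [DecidableEq n]

theorem trace_rotate {U : Op n} (hU : U * U.conjTranspose = 1) (M : SuperOp n n) :
    LinearMap.trace ℂ (Op n) (rotate U M) = LinearMap.trace ℂ (Op n) M := by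
  rw [rotate, LinearMap.trace_comp_comm', LinearMap.comp_assoc, conjBy_comp, hU, conjBy_one,
    LinearMap.comp_id]

/-- The fourth roots of unity, used as phases. -/
abbrev Phase : Type := ↥(rootsOfUnity 4 ℂ)

instance : Fintype Phase := Fintype.ofFinite _

theorem Phase.mul_conj (s : Phase) : ((s : ℂˣ) : ℂ) * star ((s : ℂˣ) : ℂ) = 1 := by
  have h : ‖((s : ℂˣ) : ℂ)‖ = 1 := Complex.norm_eq_one_of_mem_rootsOfUnity s.2
  rw [Complex.star_def, Complex.mul_conj', h]
  simp

/-- The monomial unitary `|l⟩ ↦ s_l |π l⟩`. -/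
def monomialUnitary (w : Equiv.Perm n × (n → Phase)) : Op n :=
  Matrix.of fun k l => if k = w.1 l then ((w.2 l : ℂˣ) : ℂ) else 0

theorem monomialUnitary_conjTranspose_mul (w : Equiv.Perm n × (n → Phase)) :
    (monomialUnitary w).conjTranspose * monomialUnitary w = 1 := by
  ext k l
  rw [Matrix.mul_apply, Finset.sum_eq_single (w.1 k)]
  · by_cases h : k = l
    · subst h
      simpa [monomialUnitary, mul_comm] using Phase.mul_conj (w.2 k)
    · simp [monomialUnitary, h]
  · intro p _ hp
    simp [monomialUnitary, hp]
  · simp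

theorem monomialUnitary_mul_conjTranspose (w : Equiv.Perm n × (n → Phase)) :
    monomialUnitary w * (monomialUnitary w).conjTranspose = 1 :=
  mul_eq_one_comm.mp (monomialUnitary_conjTranspose_mul w)

theorem rotate_monomialUnitary_single (w : Equiv.Perm n × (n → Phase)) (M : SuperOp n n)
    (i j k l : n) :
    rotate (monomialUnitary w) M (Matrix.single i j 1) k l =
      ((w.2 i : ℂˣ) : ℂ) * star ((w.2 j : ℂˣ) : ℂ) * star ((w.2 k : ℂˣ) : ℂ) * ((w.2 l : ℂˣ) : ℂ) *
        M (Matrix.single (w.1 i) (w.1 j) 1) (w.1 k) (w.1 l) := by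
  have h1 : conjBy (monomialUnitary w) (Matrix.single i j 1) =
      (((w.2 i : ℂˣ) : ℂ) * star ((w.2 j : ℂˣ) : ℂ)) • Matrix.single (w.1 i) (w.1 j) 1 := by
    ext p q
    rw [conjBy_apply, Matrix.mul_apply, Finset.sum_eq_single j, Matrix.mul_apply,
      Finset.sum_eq_single i]
    · by_cases hp : p = w.1 i <;> by_cases hq : q = w.1 j <;>
        simp [monomialUnitary, hp, hq, eq_comm]
    · intro x _ hx; simp [hx.symm]
    · simp
    · intro x _ hx
      rw [Matrix.mul_apply, Finset.sum_eq_zero, zero_mul]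
      intro y _; simp [hx.symm]
    · simp
  have h2 : ∀ Y : Op n, conjBy (monomialUnitary w).conjTranspose Y k l =
      star ((w.2 k : ℂˣ) : ℂ) * ((w.2 l : ℂˣ) : ℂ) * Y (w.1 k) (w.1 l) := by
    intro Y
    rw [conjBy_apply, Matrix.conjTranspose_conjTranspose, Matrix.mul_apply,
      Finset.sum_eq_single (w.1 l), Matrix.mul_apply, Finset.sum_eq_single (w.1 k)]
    · simp [monomialUnitary]; ring
    · intro x _ hx; simp [monomialUnitary, hx]
    · simp
    · intro x _ hx; simp [monomialUnitary, hx]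
    · simp
  rw [rotate, LinearMap.comp_apply, LinearMap.comp_apply, h1, map_smul, h2, Matrix.smul_apply,
    smul_eq_mul]
  ring

/-- The weight of the uniform distribution on monomial unitaries. -/
def twirlWeight (n : Type) [Fintype n] [DecidableEq n] : ℝ :=
  (Fintype.card (Equiv.Perm n × (n → Phase)) : ℝ)⁻¹

theorem twirlWeight_nonneg : 0 ≤ twirlWeight n := inv_nonneg.mpr (Nat.cast_nonneg _)

theorem sum_twirlWeight : ∑ _w : Equiv.Perm n × (n → Phase), twirlWeight n = 1 := by
  rw [Finset.sum_const, Finset.card_univ, nsmul_eq_mul, twirlWeight]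
  exact mul_inv_cancel₀ (Nat.cast_ne_zero.mpr Fintype.card_ne_zero)

/-- The average of `M` rotated by all monomial unitaries. -/
def twirl (M : SuperOp n n) : SuperOp n n :=
  ∑ w : Equiv.Perm n × (n → Phase), (twirlWeight n : ℂ) • rotate (monomialUnitary w) M

theorem twirl_single (M : SuperOp n n) (i j k l : n) :
    twirl M (Matrix.single i j 1) k l = ∑ w : Equiv.Perm n × (n → Phase), (twirlWeight n : ℂ) *
      (((w.2 i : ℂˣ) : ℂ) * star ((w.2 j : ℂˣ) : ℂ) * star ((w.2 k : ℂˣ) : ℂ) * ((w.2 l : ℂˣ) : ℂ) *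
        M (Matrix.single (w.1 i) (w.1 j) 1) (w.1 k) (w.1 l)) := by
  simp only [twirl, LinearMap.sum_apply, Matrix.sum_apply, LinearMap.smul_apply,
    Matrix.smul_apply, smul_eq_mul, rotate_monomialUnitary_single]

theorem trace_twirl (M : SuperOp n n) :
    LinearMap.trace ℂ (Op n) (twirl M) = LinearMap.trace ℂ (Op n) M := by
  simp only [twirl, map_sum, map_smul,
    trace_rotate (monomialUnitary_mul_conjTranspose _)]
  rw [← Finset.sum_smul, ← Complex.ofReal_sum, sum_twirlWeight, Complex.ofReal_one, one_smul]

/-- The sum `∑_i ⟨i| M(|i⟩⟨i|) |i⟩`. Together with the trace and trace preservation it determines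
the three coefficients of a twirled map. -/
def diagTrace (M : SuperOp n n) : ℂ := ∑ i, M (Matrix.single i i 1) i i

theorem diagTrace_twirl (M : SuperOp n n) : diagTrace (twirl M) = diagTrace M := by
  have h : ∀ w : Equiv.Perm n × (n → Phase), ∀ i,
      ((w.2 i : ℂˣ) : ℂ) * star ((w.2 i : ℂˣ) : ℂ) * star ((w.2 i : ℂˣ) : ℂ) * ((w.2 i : ℂˣ) : ℂ) *
        M (Matrix.single (w.1 i) (w.1 i) 1) (w.1 i) (w.1 i) =
      M (Matrix.single (w.1 i) (w.1 i) 1) (w.1 i) (w.1 i) := by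
    intro w i
    have := Phase.mul_conj (w.2 i)
    rw [mul_assoc (_ * _) (star _) _, mul_comm (star _), this, one_mul, one_mul]
  simp only [diagTrace, twirl_single, h]
  rw [Finset.sum_comm]
  simp only [← Finset.mul_sum]
  have h2 : ∀ w : Equiv.Perm n × (n → Phase),
      ∑ i, M (Matrix.single (w.1 i) (w.1 i) 1) (w.1 i) (w.1 i) =
        ∑ i, M (Matrix.single i i 1) i i := fun w =>
    Equiv.sum_comp w.1 fun i => M (Matrix.single i i 1) i i
  simp only [h2]
  rw [Finset.mul_sum, ← Finset.sum_mul, ← Complex.ofReal_sum, sum_twirlWeight,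
    Complex.ofReal_one, one_mul]

/-- Covariance of the twirl under diagonal unitaries with phases in the fourth roots of unity. -/
theorem twirl_single_phase (M : SuperOp n n) (t : n → Phase) (i j k l : n) :
    ((t i : ℂˣ) : ℂ) * star ((t j : ℂˣ) : ℂ) * star ((t k : ℂˣ) : ℂ) * ((t l : ℂˣ) : ℂ) *
      twirl M (Matrix.single i j 1) k l = twirl M (Matrix.single i j 1) k l := by
  rw [twirl_single, Finset.mul_sum]
  refine Fintype.sum_equiv ((Equiv.refl _).prodCongr (Equiv.mulLeft t)) _ _ fun w => ?_
  simp
  ring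

/-- Covariance of the twirl under permutations of the basis. -/
theorem twirl_single_perm (M : SuperOp n n) (σ : Equiv.Perm n) (i j k l : n) :
    twirl M (Matrix.single (σ i) (σ j) 1) (σ k) (σ l) = twirl M (Matrix.single i j 1) k l := by
  rw [twirl_single, twirl_single]
  refine Fintype.sum_equiv
    ((Equiv.mulRight σ).prodCongr (Equiv.arrowCongr σ.symm (Equiv.refl _))) _ _ fun w => ?_
  simp [Equiv.arrowCongr]

theorem exists_phase_I : ∃ s : Phase, ((s : ℂˣ) : ℂ) = Complex.I :=
  ⟨rootsOfUnity.mkOfPowEq Complex.I Complex.I_pow_four, rfl⟩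

/-- Covariance under a phase `i` on a single basis vector `p` kills all entries except those of
`|i⟩⟨j| ↦ |i⟩⟨j|` and `|i⟩⟨i| ↦ |k⟩⟨k|`. Signs alone would also leave the transposition. -/
theorem twirl_single_eq_zero (M : SuperOp n n) {i j k l : n} (h1 : ¬ (i = k ∧ j = l))
    (h2 : ¬ (i = j ∧ k = l)) : twirl M (Matrix.single i j 1) k l = 0 := by
  obtain ⟨s, hs⟩ := exists_phase_I
  have key : ∀ p : n, (if i = p then Complex.I else 1) * (if j = p then -Complex.I else 1) *
      (if k = p then -Complex.I else 1) * (if l = p then Complex.I else 1) ≠ 1 →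
      twirl M (Matrix.single i j 1) k l = 0 := by
    intro p hp
    have hval : ∀ q, (((Pi.mulSingle p s : n → Phase) q : ℂˣ) : ℂ) =
        if q = p then Complex.I else 1 := by
      intro q
      by_cases hq : q = p
      · subst hq; simp [hs]
      · simp [hq]
    have h := twirl_single_phase M (Pi.mulSingle p s) i j k l
    simp only [hval, apply_ite star, star_one, Complex.star_def, Complex.conj_I] at h
    by_contra h0
    exact hp (mul_right_cancel₀ h0 (by rw [one_mul]; exact h))
  have hI : Complex.I ≠ 1 := fun h => by simpa using congrArg Complex.re h
  have hI' : -Complex.I ≠ 1 := fun h => by simpa using congrArg Complex.re h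
  have hI2 : (-1 : ℂ) ≠ 1 := by norm_num
  by_cases hij : i = j
  · subst hij
    have hkl : k ≠ l := fun h => h2 ⟨rfl, h⟩
    refine key k ?_
    by_cases hik : i = k <;> simp [hik, hkl.symm, hI']
  · by_cases hik : i = k
    · subst hik
      have hjl : j ≠ l := fun h => h1 ⟨rfl, h⟩
      refine key j ?_
      simp [hij, hjl.symm, hI']
    · refine key i ?_
      by_cases hil : l = i <;> simp [Ne.symm hij, Ne.symm hik, hil, hI, hI2]

/-- The map that deletes the off-diagonal entries. -/
def dephase (n : Type) [DecidableEq n] : SuperOp n n where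
  toFun X := Matrix.diagonal X.diag
  map_add' X Y := by simp [Matrix.diag_add]
  map_smul' t X := by simp [Matrix.diag_smul]

/-- The map `σ ↦ Tr(σ) 1`. -/
def traceId (n : Type) [Fintype n] [DecidableEq n] : SuperOp n n :=
  (Matrix.traceLinearMap n ℂ ℂ).smulRight 1

theorem dephase_single {n : Type} [DecidableEq n] (i j k l : n) : dephase n (Matrix.single i j 1) k l =
    if i = j ∧ k = l ∧ i = k then 1 else 0 := by
  change Matrix.diagonal (Matrix.single i j (1 : ℂ)).diag k l = _
  rw [Matrix.diagonal_apply, Matrix.diag_apply, Matrix.single_apply]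
  grind

theorem traceId_single (i j k l : n) : traceId n (Matrix.single i j 1) k l =
    if i = j ∧ k = l then 1 else 0 := by
  change ((Matrix.single i j (1 : ℂ)).trace • (1 : Op n)) k l = _
  rw [Matrix.smul_apply, Matrix.one_apply]
  by_cases h1 : i = j
  · subst h1; simp
  · simp [h1, Matrix.trace_single_eq_of_ne]

theorem exists_perm_apply {n : Type} [DecidableEq n] {i₀ i₁ i j : n} (h0 : i₀ ≠ i₁) (h : i ≠ j) :
    ∃ σ : Equiv.Perm n, σ i₀ = i ∧ σ i₁ = j := by
  refine ⟨Equiv.swap (Equiv.swap i₀ i i₁) j * Equiv.swap i₀ i, ?_, ?_⟩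
  · rw [Equiv.Perm.mul_apply, Equiv.swap_apply_left]
    refine Equiv.swap_apply_of_ne_of_ne ?_ h
    intro h'
    have : Equiv.swap i₀ i i₀ = Equiv.swap i₀ i i₁ := by rw [Equiv.swap_apply_left, ← h']
    exact h0 ((Equiv.swap i₀ i).injective this)
  · rw [Equiv.Perm.mul_apply, Equiv.swap_apply_left]

/-- A monomially twirled map is a combination of the identity, the dephasing map and `Tr(·) 1`: by
2-transitivity of the permutations the surviving entries take three values. -/
theorem exists_twirl_eq [Nontrivial n] (M : SuperOp n n) : ∃ α β γ : ℂ,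
    twirl M = α • LinearMap.id + β • dephase n + γ • traceId n := by
  obtain ⟨i₀, i₁, h01⟩ := exists_pair_ne n
  set α := twirl M (Matrix.single i₀ i₁ 1) i₀ i₁ with hα
  set γ := twirl M (Matrix.single i₀ i₀ 1) i₁ i₁ with hγ
  set δ := twirl M (Matrix.single i₀ i₀ 1) i₀ i₀ with hδ
  refine ⟨α, δ - α - γ, γ, superOp_ext fun i j k l => ?_⟩
  simp only [LinearMap.add_apply, LinearMap.smul_apply, LinearMap.id_apply, Matrix.add_apply,
    Matrix.smul_apply, smul_eq_mul, dephase_single, traceId_single, Matrix.single_apply]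
  by_cases h1 : i = k ∧ j = l
  · obtain ⟨rfl, rfl⟩ := h1
    by_cases hij : i = j
    · subst hij
      have := twirl_single_perm M (Equiv.swap i₀ i) i₀ i₀ i₀ i₀
      rw [Equiv.swap_apply_left] at this
      simp [this, ← hδ]
      ring
    · obtain ⟨σ, h0, h1⟩ := exists_perm_apply h01 hij
      have := twirl_single_perm M σ i₀ i₁ i₀ i₁
      rw [h0, h1] at this
      simp [this, ← hα, hij]
  · by_cases h2 : i = j ∧ k = l
    · obtain ⟨rfl, rfl⟩ := h2
      have hik : i ≠ k := fun h => h1 ⟨h, h⟩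
      obtain ⟨σ, h0, h1⟩ := exists_perm_apply h01 hik
      have := twirl_single_perm M σ i₀ i₀ i₁ i₁
      rw [h0, h1] at this
      simp [this, ← hγ, hik]
    · rw [twirl_single_eq_zero M h1 h2]
      have : ¬ (i = j ∧ k = l ∧ i = k) := fun h => h2 ⟨h.1, h.2.1⟩
      simp [h1, h2, this]

theorem trace_id_superOp :
    LinearMap.trace ℂ (Op n) LinearMap.id = (Fintype.card n : ℂ) ^ 2 := by
  simp only [trace_superOp, LinearMap.id_apply, Matrix.single_apply_same, Finset.sum_const,
    Finset.card_univ, nsmul_eq_mul, mul_one, sq]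

theorem trace_dephase : LinearMap.trace ℂ (Op n) (dephase n) = Fintype.card n := by
  simp only [trace_superOp, dephase_single]
  simp

theorem trace_traceId : LinearMap.trace ℂ (Op n) (traceId n) = Fintype.card n := by
  simp only [trace_superOp, traceId_single]
  simp

theorem diagTrace_comb (α β γ : ℂ) (A B C : SuperOp n n) :
    diagTrace (α • A + β • B + γ • C) = α * diagTrace A + β * diagTrace B + γ * diagTrace C := by
  simp [diagTrace, Finset.sum_add_distrib, Finset.mul_sum]

theorem diagTrace_id : diagTrace (LinearMap.id : SuperOp n n) = Fintype.card n := by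
  simp [diagTrace]

theorem diagTrace_dephase : diagTrace (dephase n) = Fintype.card n := by
  simp [diagTrace, dephase_single]

theorem diagTrace_traceId : diagTrace (traceId n) = Fintype.card n := by
  simp [diagTrace, traceId_single]

theorem rotate_id {V : Op n} (hV : V.conjTranspose * V = 1) :
    rotate V LinearMap.id = LinearMap.id := by
  rw [rotate, LinearMap.id_comp, conjBy_comp, hV, conjBy_one]

theorem rotate_traceId {V : Op n} (hV : V.conjTranspose * V = 1) :
    rotate V (traceId n) = traceId n := by
  ext1 X
  change V.conjTranspose * ((V * X * V.conjTranspose).trace • (1 : Op n)) *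
    V.conjTranspose.conjTranspose = X.trace • (1 : Op n)
  rw [Matrix.trace_mul_comm, ← Matrix.mul_assoc, hV, Matrix.one_mul, Matrix.mul_smul,
    Matrix.smul_mul, Matrix.mul_one, Matrix.conjTranspose_conjTranspose, hV]

/-- A unitary with entries of equal modulus maps basis states to states that dephasing turns
into the maximally mixed state. -/
theorem diagTrace_rotate_dephase [Nonempty n] {V : Op n}
    (hV : ∀ i j, V i j * star (V i j) = 1 / (Fintype.card n : ℂ)) :
    diagTrace (rotate V (dephase n)) = 1 := by
  have hn : (Fintype.card n : ℂ) ≠ 0 := Nat.cast_ne_zero.mpr Fintype.card_ne_zero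
  have h : ∀ i, rotate V (dephase n) (Matrix.single i i 1) i i = 1 / (Fintype.card n : ℂ) := by
    intro i
    change (V.conjTranspose * Matrix.diagonal (V * Matrix.single i i 1 * V.conjTranspose).diag *
      V.conjTranspose.conjTranspose) i i = _
    have h1 : (V * Matrix.single i i 1 * V.conjTranspose).diag =
        fun _ => 1 / (Fintype.card n : ℂ) := by
      ext k
      rw [Matrix.diag_apply, Matrix.mul_apply, Finset.sum_eq_single i]
      · simp only [Matrix.mul_single_apply_same, Matrix.conjTranspose_apply, mul_one]
        exact hV k i
      · intro x _ hx; simp [Matrix.mul_single_apply_of_ne, hx]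
      · simp
    rw [h1, Matrix.conjTranspose_conjTranspose, Matrix.mul_apply]
    simp only [Matrix.mul_diagonal, Matrix.conjTranspose_apply]
    have h2 : ∀ k, star (V k i) * (1 / (Fintype.card n : ℂ)) * V k i =
        (1 / (Fintype.card n : ℂ)) * (1 / (Fintype.card n : ℂ)) := fun k => by
      rw [← hV k i]; ring
    simp only [h2, Finset.sum_const, Finset.card_univ, nsmul_eq_mul]
    field_simp
  simp only [diagTrace, h, Finset.sum_const, Finset.card_univ, nsmul_eq_mul]
  field_simp

theorem rotate_mem_simulable {a' b' : Type*} [Fintype a'] [Fintype b'] {N : SuperOp a' b'}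
    {M : SuperOp n n} (hM : M ∈ simulable n n N) {U : Op n} (hU : U.conjTranspose * U = 1) :
    rotate U M ∈ simulable n n N :=
  comp_mem_simulable hM (IsChannel.conjBy hU) (IsChannel.conjBy (by
    rw [Matrix.conjTranspose_conjTranspose]; exact mul_eq_one_comm.mp hU))

theorem twirl_mem_simulable {a' b' : Type*} [Fintype a'] [Fintype b'] {N : SuperOp a' b'}
    {M : SuperOp n n} (hM : M ∈ simulable n n N) : twirl M ∈ simulable n n N :=
  convexSum_mem_simulable (fun _ => twirlWeight_nonneg) sum_twirlWeight fun w =>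
    rotate_mem_simulable hM (monomialUnitary_conjTranspose_mul w)

end Twirl

/-! ### Heisenberg–Weyl operators and the Fourier matrix -/

section Weyl

variable {d : ℕ}

/-- The phase `exp(2πi k z / d)`. -/
def fourierPhase (k z : Fin d) : ℂ :=
  Complex.exp (2 * Real.pi * Complex.I * ((k : ℕ) : ℂ) * ((z : ℕ) : ℂ) / (d : ℂ))

theorem fourierPhase_eq_pow (k z : Fin d) :
    fourierPhase k z = (Complex.exp (2 * Real.pi * Complex.I / (d : ℂ)) ^ (k : ℕ)) ^ (z : ℕ) := by
  rw [← pow_mul, ← Complex.exp_nat_mul, fourierPhase]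
  congr 1
  push_cast
  ring

theorem fourierPhase_mul_star (k z : Fin d) : fourierPhase k z * star (fourierPhase k z) = 1 := by
  have h : fourierPhase k z = Complex.exp
      (((2 * Real.pi * ((k : ℕ) : ℝ) * ((z : ℕ) : ℝ) / (d : ℝ) : ℝ) : ℂ) * Complex.I) := by
    rw [fourierPhase]
    congr 1
    push_cast
    ring
  rw [Complex.star_def, Complex.mul_conj', h, Complex.norm_exp_ofReal_mul_I]
  simp

theorem sum_fourierPhase [NeZero d] (k l : Fin d) :
    ∑ z, fourierPhase k z * star (fourierPhase l z) = if k = l then (d : ℂ) else 0 := by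
  split_ifs with h
  · subst h
    simp only [fourierPhase_mul_star, Finset.sum_const, Finset.card_univ, Fintype.card_fin,
      nsmul_eq_mul, mul_one]
  · set ω := Complex.exp (2 * Real.pi * Complex.I / (d : ℂ)) with hω
    have hprim : IsPrimitiveRoot ω d := Complex.isPrimitiveRoot_exp d (NeZero.ne d)
    have hω0 : ω ≠ 0 := Complex.exp_ne_zero _
    have hterm : ∀ z : Fin d, fourierPhase k z * star (fourierPhase l z) =
        (ω ^ (k : ℕ) / ω ^ (l : ℕ)) ^ (z : ℕ) := by
      intro z
      have h1 := fourierPhase_mul_star l z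
      rw [fourierPhase_eq_pow k, ← hω, div_pow, eq_div_iff (pow_ne_zero _ (pow_ne_zero _ hω0)),
        mul_assoc, hω, ← fourierPhase_eq_pow l, mul_comm (star _), h1, mul_one]
    have hne : ω ^ (k : ℕ) / ω ^ (l : ℕ) ≠ 1 := by
      rw [Ne, div_eq_one_iff_eq (pow_ne_zero _ hω0)]
      exact fun h' => h (Fin.ext (hprim.pow_inj k.2 l.2 h'))
    have hpow : (ω ^ (k : ℕ) / ω ^ (l : ℕ)) ^ d = 1 := by
      rw [div_pow, ← pow_mul, ← pow_mul, mul_comm, mul_comm (l : ℕ), pow_mul, pow_mul,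
        hprim.pow_eq_one, one_pow, one_pow, div_one]
    simp only [hterm]
    rw [Fin.sum_univ_eq_sum_range (fun z => (ω ^ (k : ℕ) / ω ^ (l : ℕ)) ^ z), geom_sum_eq hne,
      hpow, sub_self, zero_div]

/-- The unitary matrix of the discrete Fourier transform. -/
def fourierMatrix (d : ℕ) : Op (Fin d) :=
  Matrix.of fun k l => (((Real.sqrt d)⁻¹ : ℝ) : ℂ) * fourierPhase k l

theorem inv_sqrt_mul_self (d : ℕ) :
    (((Real.sqrt d)⁻¹ : ℝ) : ℂ) * (((Real.sqrt d)⁻¹ : ℝ) : ℂ) = 1 / (d : ℂ) := by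
  rw [← Complex.ofReal_mul, ← mul_inv, Real.mul_self_sqrt (Nat.cast_nonneg d)]
  simp

theorem fourierMatrix_apply_mul_star (k l m : Fin d) :
    fourierMatrix d k m * star (fourierMatrix d l m) =
      1 / (d : ℂ) * (fourierPhase k m * star (fourierPhase l m)) := by
  simp only [fourierMatrix, Matrix.of_apply, star_mul', ← inv_sqrt_mul_self]
  rw [Complex.star_def, Complex.conj_ofReal]
  ring

theorem fourierMatrix_conjTranspose_mul [NeZero d] :
    (fourierMatrix d).conjTranspose * fourierMatrix d = 1 := by
  have hd : (d : ℂ) ≠ 0 := Nat.cast_ne_zero.mpr (NeZero.ne d)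
  refine mul_eq_one_comm.mp ?_
  ext k l
  simp only [Matrix.mul_apply, Matrix.conjTranspose_apply, fourierMatrix_apply_mul_star]
  rw [← Finset.mul_sum, sum_fourierPhase, Matrix.one_apply]
  split_ifs
  · exact one_div_mul_cancel hd
  · exact mul_zero _

theorem heisenbergWeyl_apply (z x p q : Fin d) :
    heisenbergWeyl z x p q = if p = q + x then fourierPhase p z else 0 := by
  rw [heisenbergWeyl, clockZ, shiftX, Matrix.diagonal_mul, Matrix.sum_apply,
    Finset.sum_eq_single q]
  · simp [Matrix.single_apply, fourierPhase, eq_comm]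
  · intro r _ hr; simp [hr]
  · simp

theorem heisenbergWeyl_zero [NeZero d] : heisenbergWeyl (0 : Fin d) 0 = 1 := by
  ext p q
  simp [heisenbergWeyl_apply, fourierPhase, Matrix.one_apply]

/-- Summing over `z` removes the off-diagonal entries, summing over `x` averages the diagonal. -/
theorem sum_conjBy_heisenbergWeyl [NeZero d] :
    ∑ w : Fin d × Fin d, conjBy (heisenbergWeyl w.1 w.2) = (d : ℂ) • traceId (Fin d) := by
  ext1 X
  ext p q
  have hentry : ∀ z x : Fin d, conjBy (heisenbergWeyl z x) X p q =
      X (p - x) (q - x) * (fourierPhase p z * star (fourierPhase q z)) := by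
    intro z x
    rw [conjBy_apply, Matrix.mul_apply, Finset.sum_eq_single (q - x), Matrix.mul_apply,
      Finset.sum_eq_single (p - x)]
    · simp [heisenbergWeyl_apply]; ring
    · intro r _ hr
      have : p ≠ r + x := fun h => hr (by rw [h, add_sub_cancel_right])
      simp [heisenbergWeyl_apply, this]
    · simp
    · intro r _ hr
      have : q ≠ r + x := fun h => hr (by rw [h, add_sub_cancel_right])
      simp [heisenbergWeyl_apply, this]
    · simp
  have hR : ((d : ℂ) • traceId (Fin d)) X p q = (d : ℂ) * (X.trace * (1 : Op (Fin d)) p q) := rfl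
  rw [hR, LinearMap.sum_apply, Matrix.sum_apply, Fintype.sum_prod_type, Finset.sum_comm]
  simp only [hentry]
  simp only [← Finset.mul_sum, sum_fourierPhase, Matrix.one_apply]
  split_ifs with h
  · subst h
    have hshift : ∑ x, X (p - x) (p - x) = X.trace :=
      Equiv.sum_comp (Equiv.subLeft p) fun i => X i i
    rw [← Finset.sum_mul, hshift, mul_one, mul_comm]
  · simp

theorem randomizing_eq [NeZero d] : randomizing d =
    (1 / ((d : ℂ) ^ 2 - 1)) • ((d : ℂ) • traceId (Fin d) - LinearMap.id) := by
  rw [randomizing, ← sum_conjBy_heisenbergWeyl, ← Finset.sum_erase_add _ _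
    (Finset.mem_univ ((0, 0) : Fin d × Fin d)), heisenbergWeyl_zero, conjBy_one,
    add_sub_cancel_right]

theorem isCP_randomizing [NeZero d] : IsCP (randomizing d) := by
  refine IsCP.smul (IsCP.sum _ fun w _ => IsCP.conjBy _) ?_
  have hd : (1 : ℝ) ≤ d := by exact_mod_cast NeZero.one_le
  have h : (1 / ((d : ℂ) ^ 2 - 1)) = ((1 / ((d : ℝ) ^ 2 - 1) : ℝ) : ℂ) := by push_cast; rfl
  -- For `d = 1` the prefactor is `1 / 0 = 0`.
  rw [h, Complex.zero_le_real]
  exact one_div_nonneg.mpr (by nlinarith)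

end Weyl

/-! ### Isotropic twirling -/

section Isotropic

variable {d : ℕ} [NeZero d] {a' b' : Type*} [Fintype a'] [Fintype b']

/-- Mixing the monomial twirl of `M` with the monomial twirl of its Fourier rotation, in
proportion `1 : d`, cancels the dephasing component: rotating and twirling turns the dephasing map
into a combination in which it has the coefficient `-1 / d`. -/
theorem exists_isotropic_mem_simulable [Nontrivial (Fin d)] {N : SuperOp a' b'}
    (hN : IsChannel N) {M : SuperOp (Fin d) (Fin d)} (hM : M ∈ simulable (Fin d) (Fin d) N) :
    ∃ α γ : ℂ, α • LinearMap.id + γ • traceId (Fin d) ∈ simulable (Fin d) (Fin d) N ∧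
      α + γ * d = 1 ∧
      α * (d : ℂ) ^ 2 + γ * d = LinearMap.trace ℂ (Op (Fin d)) M := by
  have hd : (d : ℂ) ≠ 0 := Nat.cast_ne_zero.mpr (NeZero.ne d)
  have hd1 : (1 : ℂ) - d ≠ 0 := by
    have h1 : d ≠ 1 := by
      rintro rfl
      exact not_subsingleton (Fin 1) inferInstance
    rw [sub_ne_zero]
    exact_mod_cast h1.symm
  have hd2 : (d : ℂ) + 1 ≠ 0 := by exact_mod_cast Nat.succ_ne_zero d
  set V := fourierMatrix d with hVdef
  have hV : V.conjTranspose * V = 1 := fourierMatrix_conjTranspose_mul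
  have hVent : ∀ i j, V i j * star (V i j) = 1 / (Fintype.card (Fin d) : ℂ) := fun i j => by
    rw [fourierMatrix_apply_mul_star, fourierPhase_mul_star, mul_one, Fintype.card_fin]
  have htp : ∀ {α β γ : ℂ},
      α • LinearMap.id + β • dephase (Fin d) + γ • traceId (Fin d) ∈ simulable (Fin d) (Fin d) N →
      α + β + γ * d = 1 := by
    intro α β γ h
    have h1 := (isChannel_of_mem_simulable hN h).tp (Matrix.single 0 0 1)
    have h2 : (dephase (Fin d) (Matrix.single 0 0 1)).trace = 1 := by
      simp [Matrix.trace, dephase_single]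
    have h3 : (traceId (Fin d) (Matrix.single 0 0 1)).trace = d := by
      simp [Matrix.trace, traceId_single]
    simpa [Matrix.trace_add, h2, h3] using h1
  obtain ⟨α, β, γ, h1⟩ := exists_twirl_eq M
  have hM1 := twirl_mem_simulable hM
  rw [h1] at hM1
  set M₁ := α • LinearMap.id + β • dephase (Fin d) + γ • traceId (Fin d) with hM₁
  let p : Bool → ℝ := fun c => if c then 1 / ((d : ℝ) + 1) else d / ((d : ℝ) + 1)
  let K : Bool → SuperOp (Fin d) (Fin d) := fun c => if c then M₁ else rotate V M₁
  have hM2 : ∑ c, (p c : ℂ) • K c ∈ simulable (Fin d) (Fin d) N := by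
    refine convexSum_mem_simulable ?_ ?_ ?_
    · intro c; cases c <;> simp only [p] <;> simp <;> positivity
    · have : (d : ℝ) + 1 ≠ 0 := by positivity
      simp [p]
      field_simp
      ring
    · intro c; cases c
      · simpa [K] using rotate_mem_simulable hM1 hV
      · simpa [K] using hM1
  have htrK : LinearMap.trace ℂ (Op (Fin d)) (∑ c, (p c : ℂ) • K c) =
      LinearMap.trace ℂ (Op (Fin d)) M := by
    simp [p, K, trace_rotate (mul_eq_one_comm.mp hV), ← h1, trace_twirl]
    field_simp
    ring
  have hrot : rotate V M₁ =
      α • LinearMap.id + β • rotate V (dephase (Fin d)) + γ • traceId (Fin d) := by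
    conv_rhs => rw [← rotate_id hV, ← rotate_traceId hV]
    simp only [hM₁, rotate, LinearMap.comp_add, LinearMap.add_comp, LinearMap.comp_smul,
      LinearMap.smul_comp]
  have hdiag : diagTrace (∑ c, (p c : ℂ) • K c) = d * (α + γ) + 2 * d / (d + 1) * β := by
    have hlin : diagTrace (∑ c, (p c : ℂ) • K c) =
        (1 / ((d : ℂ) + 1)) * diagTrace M₁ + (d / ((d : ℂ) + 1)) * diagTrace (rotate V M₁) := by
      have := diagTrace_comb (1 / ((d : ℂ) + 1)) (d / ((d : ℂ) + 1)) 0 M₁ (rotate V M₁) 0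
      rw [zero_mul, add_zero] at this
      rw [← this]
      simp [p, K]
    rw [hlin, hrot, hM₁, diagTrace_comb, diagTrace_comb, diagTrace_id, diagTrace_dephase,
      diagTrace_traceId, diagTrace_rotate_dephase hVent, Fintype.card_fin]
    field_simp
    ring
  obtain ⟨α', β', γ', h2⟩ := exists_twirl_eq (∑ c, (p c : ℂ) • K c)
  have hM2' := twirl_mem_simulable hM2
  have e1 := trace_twirl (∑ c, (p c : ℂ) • K c)
  have e2 := diagTrace_twirl (∑ c, (p c : ℂ) • K c)
  have e4 := trace_twirl M
  rw [h2] at hM2' e1 e2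
  rw [h1, hM₁] at e4
  rw [hdiag, diagTrace_comb, diagTrace_id, diagTrace_dephase, diagTrace_traceId,
    Fintype.card_fin] at e2
  rw [htrK] at e1
  simp only [map_add, map_smul, smul_eq_mul, trace_id_superOp, trace_dephase, trace_traceId,
    Fintype.card_fin] at e1 e4
  have e3 := htp hM2'
  have e5 := htp hM1
  -- Three linear equations for the new coefficients: trace preservation, trace, diagonal trace.
  have hβ : β' = 0 := by
    have e2' : α' + β' + γ' = α + γ + 2 / (d + 1) * β := by
      refine mul_left_cancel₀ hd ?_
      linear_combination e2
    have e1' : α' * d + β' + γ' = α * d + β + γ := by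
      refine mul_left_cancel₀ hd ?_
      linear_combination e1 - e4
    have h2' : ((d : ℂ) + 1) * (2 / (d + 1) * β) = 2 * β := by field_simp
    refine (mul_eq_zero.mp ?_).resolve_left hd1
    linear_combination e3 - e5 + e1' - (d + 1) * e2' - h2'
  subst hβ
  rw [zero_smul, add_zero] at hM2'
  exact ⟨α', γ', hM2', by linear_combination e3, by linear_combination e1⟩

/-- Every simulable channel can be twirled into the isotropic channel with the same entanglement
fidelity. -/
theorem isotropic_mem_simulable {N : SuperOp a' b'} (hN : IsChannel N)
    {M : SuperOp (Fin d) (Fin d)} (hM : M ∈ simulable (Fin d) (Fin d) N) :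
    (entanglementFidelity M : ℂ) • LinearMap.id +
      ((1 - entanglementFidelity M : ℝ) : ℂ) • randomizing d ∈ simulable (Fin d) (Fin d) N := by
  have hchan := isChannel_of_mem_simulable hN hM
  -- For `d = 1` trace preservation alone forces `M = id`.
  rcases subsingleton_or_nontrivial (Fin d) with hs | hs
  · have hid : M = LinearMap.id := by
      ext1 X
      ext i j
      have h := hchan.tp X
      rw [Matrix.trace, Matrix.trace, Fintype.sum_subsingleton _ i,
        Fintype.sum_subsingleton _ i] at h
      rw [Subsingleton.elim j i]
      exact h
    have hd : d = 1 := by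
      have := Fintype.card_le_one_iff_subsingleton.mpr hs
      rw [Fintype.card_fin] at this
      have := NeZero.one_le (n := d)
      omega
    have hE : entanglementFidelity M = 1 := by
      rw [hid, entanglementFidelity_eq_trace, trace_id_superOp, Fintype.card_fin, hd]
      simp
    rw [hE]
    simpa [← hid] using hM
  · obtain ⟨α, γ, hmem, h1, h2⟩ := exists_isotropic_mem_simulable hN hM
    have hd : (d : ℂ) ≠ 0 := Nat.cast_ne_zero.mpr (NeZero.ne d)
    have hd1 : (d : ℂ) ^ 2 - 1 ≠ 0 := by
      have : 1 < d := by
        have := Fintype.one_lt_card_iff_nontrivial.mpr hs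
        rwa [Fintype.card_fin] at this
      rw [sub_ne_zero]
      exact_mod_cast (Nat.one_lt_pow two_ne_zero this).ne'
    have hE := coe_entanglementFidelity hchan
    set E : ℂ := (entanglementFidelity M : ℂ) with hEdef
    rw [← h2, eq_div_iff (pow_ne_zero 2 hd)] at hE
    have hE' : E * d = α * d + γ := mul_right_cancel₀ hd (by linear_combination hE)
    have hα : α = E - (1 - E) * (1 / ((d : ℂ) ^ 2 - 1)) := by
      field_simp
      linear_combination -d * hE' - h1
    have hγ : γ = (1 - E) * (1 / ((d : ℂ) ^ 2 - 1)) * d := by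
      field_simp
      linear_combination d * h1 + hE'
    have : E • LinearMap.id + ((1 - entanglementFidelity M : ℝ) : ℂ) • randomizing d =
        α • LinearMap.id + γ • traceId (Fin d) := by
      rw [randomizing_eq, hα, hγ, Complex.ofReal_sub, Complex.ofReal_one, ← hEdef]
      module
    rw [this]
    exact hmem

end Isotropic

/-! ### Optimal simulation errors -/

section Optimality

variable {d : ℕ} [NeZero d] {a' b' : Type*} [Fintype a'] [Fintype b']

theorem one_sub_iSup_le_simError {N : SuperOp a' b'} (hN : IsChannel N)
    (h : BddAbove (Set.range (entFidelity N : LOCRProtocol (Fin d) a' b' (Fin d) → ℝ)))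
    {Υ : SuperOp a' b' →ₗ[ℂ] SuperOp (Fin d) (Fin d)} (hΥ : Υ ∈ LOCR (Fin d) a' b' (Fin d)) :
    1 - (⨆ P : LOCRProtocol (Fin d) a' b' (Fin d), entFidelity N P) ≤ simError N Υ ∧
    1 - (⨆ P : LOCRProtocol (Fin d) a' b' (Fin d), entFidelity N P) ≤ simErrorF N Υ := by
  obtain ⟨P, rfl⟩ := hΥ
  have hchan : IsChannel (P.superchannel N) := isChannel_of_mem_simulable hN ⟨P, rfl⟩
  have hle : 1 - (⨆ P : LOCRProtocol (Fin d) a' b' (Fin d), entFidelity N P) ≤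
      1 - entanglementFidelity (P.superchannel N) :=
    sub_le_sub_left (entFidelity_eq N P ▸ le_ciSup h P) 1
  exact ⟨hle.trans (one_sub_entanglementFidelity_le_diamondDist hchan),
    hle.trans (one_sub_entanglementFidelity_le_infidelity hchan)⟩

end Optimality

end QI

end

open QI
theorem proposition5 (d : ℕ) [NeZero d] {a' b' : Type*} [Fintype a'] [Nonempty a'] [Fintype b']
    (N : SuperOp a' b') (hN : IsChannel N) :
    -- the two simulation errors coincide, and both are one minus the best entanglement fidelity
    eLOCR (Fin d) N = eLOCRF (Fin d) N ∧
    eLOCRF (Fin d) N = 1 - (⨆ P : LOCRProtocol (Fin d) a' b' (Fin d), entFidelity N P) ∧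
    -- every entanglement fidelity lies in `[0, 1]`
    (∀ P : LOCRProtocol (Fin d) a' b' (Fin d), entFidelity N P ∈ Set.Icc (0 : ℝ) 1) ∧
    -- the supremum is attained
    (∃ P : LOCRProtocol (Fin d) a' b' (Fin d),
      entFidelity N P = (⨆ P' : LOCRProtocol (Fin d) a' b' (Fin d), entFidelity N P')) ∧
    -- for the optimal value `E_F`, the channel `E_F id + (1 - E_F) D` is an LOCR simulation
    -- channel that is optimal for both errors
    (∀ P : LOCRProtocol (Fin d) a' b' (Fin d),
      entFidelity N P = (⨆ P' : LOCRProtocol (Fin d) a' b' (Fin d), entFidelity N P') →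
      ∃ Υ ∈ LOCR (Fin d) a' b' (Fin d),
        Υ N = (entFidelity N P : ℂ) • LinearMap.id
          + ((1 - entFidelity N P : ℝ) : ℂ) • randomizing d ∧
        simError N Υ = eLOCR (Fin d) N ∧
        simErrorF N Υ = eLOCRF (Fin d) N) := by
  have hIcc : ∀ P : LOCRProtocol (Fin d) a' b' (Fin d), entFidelity N P ∈ Set.Icc (0 : ℝ) 1 := by
    intro P
    rw [entFidelity_eq]
    exact entanglementFidelity_mem_Icc (isChannel_of_mem_simulable hN ⟨P, rfl⟩)
  have hbdd : BddAbove (Set.range (entFidelity N : LOCRProtocol (Fin d) a' b' (Fin d) → ℝ)) :=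
    ⟨1, by rintro _ ⟨P, rfl⟩; exact (hIcc P).2⟩
  obtain ⟨P₀, hP₀⟩ := exists_optimal_protocol (a := Fin d) N
  have hatt : entFidelity N P₀ =
      (⨆ P' : LOCRProtocol (Fin d) a' b' (Fin d), entFidelity N P') := by
    have : Nonempty (LOCRProtocol (Fin d) a' b' (Fin d)) := ⟨P₀⟩
    exact le_antisymm (le_ciSup hbdd P₀) (ciSup_le hP₀)
  have hopt : ∀ P : LOCRProtocol (Fin d) a' b' (Fin d),
      entFidelity N P = (⨆ P' : LOCRProtocol (Fin d) a' b' (Fin d), entFidelity N P') →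
      ∃ Υ ∈ LOCR (Fin d) a' b' (Fin d),
        Υ N = (entFidelity N P : ℂ) • LinearMap.id
          + ((1 - entFidelity N P : ℝ) : ℂ) • randomizing d ∧
        IsLeast (simError N '' LOCR (Fin d) a' b' (Fin d)) (simError N Υ) ∧
        IsLeast (simErrorF N '' LOCR (Fin d) a' b' (Fin d)) (simErrorF N Υ) ∧
        simError N Υ = 1 - entFidelity N P ∧ simErrorF N Υ = 1 - entFidelity N P := by
    intro P hP
    obtain ⟨P', hP'⟩ := isotropic_mem_simulable hN ⟨P, rfl⟩
    rw [← entFidelity_eq] at hP'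
    have hR : IsCP (((1 - entFidelity N P : ℝ) : ℂ) • randomizing d) :=
      isCP_randomizing.smul (Complex.zero_le_real.mpr (sub_nonneg.mpr (hIcc P).2))
    have hchan := isChannel_of_mem_simulable hN ⟨P', rfl⟩
    have hmem : P'.superchannel ∈ LOCR (Fin d) a' b' (Fin d) := ⟨P', rfl⟩
    have hlow := fun Υ hΥ => hP ▸ one_sub_iSup_le_simError (d := d) hN hbdd (Υ := Υ) hΥ
    have h1 : simError N P'.superchannel = 1 - entFidelity N P :=
      le_antisymm (diamondDist_id_le hchan hR (hIcc P).2 hP') (hlow _ hmem).1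
    have h2 : simErrorF N P'.superchannel = 1 - entFidelity N P :=
      le_antisymm (infidelity_id_le hR (hIcc P).1 hP') (hlow _ hmem).2
    refine ⟨P'.superchannel, hmem, hP', ⟨⟨_, hmem, rfl⟩, ?_⟩, ⟨⟨_, hmem, rfl⟩, ?_⟩, h1, h2⟩
    · rintro _ ⟨Υ, hΥ, rfl⟩
      exact h1.trans_le (hlow Υ hΥ).1
    · rintro _ ⟨Υ, hΥ, rfl⟩
      exact h2.trans_le (hlow Υ hΥ).2
  obtain ⟨Υ₀, -, -, hleast, hleastF, he, heF⟩ := hopt P₀ hatt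
  have hvalF : eLOCRF (Fin d) N =
      1 - (⨆ P : LOCRProtocol (Fin d) a' b' (Fin d), entFidelity N P) := by
    rw [eLOCRF, hleastF.csInf_eq, heF, hatt]
  have hval : eLOCR (Fin d) N = eLOCRF (Fin d) N := by
    rw [eLOCR, eLOCRF, hleast.csInf_eq, hleastF.csInf_eq, he, heF]
  refine ⟨hval, hvalF, hIcc, ⟨P₀, hatt⟩, fun P hP => ?_⟩
  obtain ⟨Υ, hΥ, heq, h1, h2, -, -⟩ := hopt P hP
  exact ⟨Υ, hΥ, heq, h1.csInf_eq.symm, h2.csInf_eq.symm⟩
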